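/- **Setting.** Let $p,q,\ell\ge 0$ be integers. For every $A\subseteq\{1,\dots,q\}$ (a submodel: it contains the $p$ common parameters and the optional parameters with index in $A$) let $\Theta_A\subseteq\mathbb R^{p+|A|}$ be open, and let $f_{A,i}(\cdot,b)$, $b\in\Theta_A$, $i\ge 1$, be probability densities with respect to a fixed measure, whose support may depend on $i$ but not on $A$ or $b$. Let $Y_1,Y_2,\dots$ be independent, $Y_i$ having the density $f_{A_0,i}(\cdot,b_0)$ for some $A_0$ and $b_0\in\Theta_{A_0}$. For $b\in\mathbb R^{p+|A|}$ and a fixed vector $c_A$ of real values for the components missing from $A$, let $\tilde b\in\mathbb R^{p+q}$ be the augmented vector, obtained by inserting $c_A$ at the missing places; $\beta_{\rm true}\in\mathbb R^{p+q}$ is $b_0$ augmented by some fixed values. Write $\ell_{A;i}(b)=\log f_{A,i}(Y_i,b)$, with gradient $\ell'_{A;i}$ and Hessian $\ell''_{A;i}$ in $b$, and $\ell_A=\sum_{i\le n}\ell_{A;i}$, $S_A=\sum_{i\le n}\ell'_{A;i}$. Let $\mathcal M$ be any set of submodels (the candidate models), indexed by $k$, with $\widetilde\beta_k$ and $\widetilde\beta^*_k$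 denoting the augmented versions of $\hat\beta_k$ and $\beta_k^*$ below. Let $w_k\ge 0$ be fixed weights with $\sum_{k\in\mathcal M}w_k=1$. For each $k\in\mathcal M$ assume: 1. $\beta^*_k\in\Theta_k$ solves $\mathbb E S_k(\beta^*_k)=0$ for every $n$. The random vector $\hat\beta_k=\hat\beta_{k,n}$ maximizes $\ell_k$ over $\Theta_k$ with probability tending to one (it is the MLE). 2. (Regularity; pointwise statements hold for all observations in the support.) - (i) $\ell_{k;i}$ is continuously differentiable on $\Theta_k$, and every $b\in\Theta_k$ has a ball around it in $\Theta_k$ on which $\|\ell'_{k;i}\|\le B_i(Y_i)$ for measurable $B_i$ with $\sup_n\frac1n\sum_{i\le n}\mathbb E B_i(Y_i)<\infty$. - (ii) $\mathbb E\|\ell'_{k;i}(\beta^*_k)\|^2<\infty$ for all $i$, and $\sup_n\frac1n\sum_{i\le n}\mathbb E\|\ell'_{k;i}(\beta^*_k)\|^2<\infty$. - (iii) The Hessians $\ell''_{k;i}(\beta^*_k)$, $i\ge1$, are uniformly integrable, and $H_k=\lim_n\frac1n\mathbb E\,\ell''_k(\beta_k^*)$ exists and is invertible. - (iv) For each $\eta>0$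 there are a ball around $\beta_k^*$ in $\Theta_k$, on which $\ell''_{k;i}$ exists for all $i$, and measurable $D_i$ such that $\|\ell''_{k;i}(t)-\ell''_{k;i}(\beta_k^*)\|\le D_i(Y_i)$ for $t$ in the ball, $D_i(Y_i)$ is integrable, and $\frac1n\sum_{i\le n}\mathbb E D_i(Y_i)\le\eta$ for all large $n$. - (v) For each $b\in\Theta_k$ the variables $\ell_{k;i}(b)-\ell_{k;i}(\beta^*_k)$, $i\ge1$, are uniformly integrable and, if $b\ne\beta_k^*$, $\lim_n\frac1n\sum_{i\le n}\mathbb E[\ell_{k;i}(b)-\ell_{k;i}(\beta_k^*)]$ exists and is negative. - (vi) For some compact $K\subseteq\Theta_k$, the probability that $\ell_k(b)\ge\ell_k(\beta_k^*)$ for some $b\in\Theta_k\setminus K$ tends to $0$. Let $\mu:\mathbb R^{p+q}\to\mathbb R^{\ell}$ be measurable and differentiable at $\widetilde\beta^*_k$ for all $k\in\mathcal M$. Put $Z_{k;i}=\nabla\mu(\widetilde\beta_k^*)\,H_k^{-1}\ell'_{k;i}(\beta_k^*)\in\mathbb R^\ell$, where $\nabla\mu$ is restricted to the partial derivatives in the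 components of model $k$. Assume (A1) $\displaystyle\lim_{n\to\infty}\frac1n\sum_{i=1}^n\mathbb E\Big[\max_{k\in\mathcal M}\|Z_{k;i}\|^2\ \mathbb I\Big\{\max_{k\in\mathcal M}\|Z_{k;i}\|>\sqrt n\,\varepsilon\Big\}\Big]=0$ for every $\varepsilon>0$, and that the limit $\displaystyle\Sigma_w=\lim_{n\to\infty}\frac1n\sum_{i=1}^n\mathbb E\Big[\Big(\sum_{k\in\mathcal M}w_kZ_{k;i}\Big)^{\otimes2}\Big]$ exists. **Theorem.** Then $$\sqrt n\sum_{k\in\mathcal M}w_k\{\mu(\widetilde\beta_k)-\mu(\beta_{\rm true})\}-\sqrt n\sum_{k\in\mathcal M}w_k\{\mu(\widetilde\beta^*_k)-\mu(\beta_{\rm true})\}\ \xrightarrow{d}\ \mathcal N(0,\Sigma_w).$$ -/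

import Mathlib

open MeasureTheory ProbabilityTheory Filter Topology

/-- Parameter vectors of the candidate model that contains the `p` common components and those of
the `q` optional components whose index lies in `A`. -/
abbrev SubParam (p : ℕ) {q : ℕ} (A : Finset (Fin q)) : Type :=
  EuclideanSpace ℝ (Fin p ⊕ A)

/-- Parameter vectors of full length `p + q`. -/
abbrev FullParam (p q : ℕ) : Type :=
  EuclideanSpace ℝ (Fin p ⊕ Fin q)

/-- The `c`-augmented version of `b`: the components missing from the model `A` are filled with
the fixed values `c j`; the values `c j` with `j ∈ A` are not used. -/
noncomputable def augment {p q : ℕ} {A : Finset (Fin q)} (c : Fin q → ℝ) (b : SubParam p A) :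
    FullParam p q :=
  WithLp.toLp 2 (Sum.elim (fun i => b (Sum.inl i))
    (fun j => if h : j ∈ A then b (Sum.inr ⟨j, h⟩) else c j))

/-- The parametric densities of all `2 ^ q` submodels. The `i`-th observation has under the
model `A` and the parameter `b ∈ Θ A` the density `density A i · b` with respect to `ν`
(the observations need not be identically distributed). The parameter spaces are open and the
support of the densities is independent of the parameter. -/
structure ModelFamily (p q : ℕ) (Obs : Type*) [MeasurableSpace Obs] (ν : Measure Obs) where
  Θ : ∀ A : Finset (Fin q), Set (SubParam p A)
  isOpen_Θ : ∀ A, IsOpen (Θ A)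
  supp : ℕ → Set Obs
  density : ∀ A : Finset (Fin q), ℕ → Obs → SubParam p A → ℝ
  measurable_density : ∀ A i, ∀ b ∈ Θ A, Measurable fun y => density A i y b
  density_nonneg : ∀ A i y, ∀ b ∈ Θ A, 0 ≤ density A i y b
  lintegral_density : ∀ A i, ∀ b ∈ Θ A, ∫⁻ y, ENNReal.ofReal (density A i y b) ∂ν = 1
  support_density : ∀ A i, ∀ b ∈ Θ A, (Function.support fun y => density A i y b) = supp i

namespace ModelFamily

variable {p q : ℕ} {Obs : Type*} [MeasurableSpace Obs] {ν : Measure Obs}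

/-- The distribution of the `i`-th observation under the model `A` and the parameter `b`. -/
noncomputable def law (F : ModelFamily p q Obs ν) (A : Finset (Fin q)) (i : ℕ)
    (b : SubParam p A) : Measure Obs :=
  ν.withDensity fun y => ENNReal.ofReal (F.density A i y b)

/-- The log-likelihood of the `i`-th observation `y` in the model `A`. -/
noncomputable def logDensity (F : ModelFamily p q Obs ν) (A : Finset (Fin q)) (i : ℕ) (y : Obs)
    (b : SubParam p A) : ℝ :=
  Real.log (F.density A i y b)

/-- The gradient of the log-likelihood of the `i`-th observation. -/
noncomputable def score (F : ModelFamily p q Obs ν) (A : Finset (Fin q)) (i : ℕ) (y : Obs)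
    (b : SubParam p A) : SubParam p A :=
  gradient (F.logDensity A i y) b

/-- The Hessian of the log-likelihood of the `i`-th observation, as a linear map. -/
noncomputable def hess (F : ModelFamily p q Obs ν) (A : Finset (Fin q)) (i : ℕ) (y : Obs)
    (b : SubParam p A) : SubParam p A →L[ℝ] SubParam p A :=
  fderiv ℝ (F.score A i y) b

/-- The log-likelihood of the first `n` observations in the model `A`. -/
noncomputable def logLik (F : ModelFamily p q Obs ν) (A : Finset (Fin q)) (n : ℕ) (y : ℕ → Obs)
    (b : SubParam p A) : ℝ :=
  ∑ i ∈ Finset.range n, F.logDensity A i (y i) b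

/-- The score function of the model `A` based on the first `n` observations. -/
noncomputable def totalScore (F : ModelFamily p q Obs ν) (A : Finset (Fin q)) (n : ℕ)
    (y : ℕ → Obs) (b : SubParam p A) : SubParam p A :=
  ∑ i ∈ Finset.range n, F.score A i (y i) b

variable {Ω : Type*} [MeasurableSpace Ω]

/-- `bhat n` is a maximum likelihood estimator in the model `A` from the first `n` observations:
a random vector which maximizes the likelihood over the parameter space. Since a maximizer may
fail to exist for exceptional data, this is required with probability tending to one. -/
structure IsMLE (F : ModelFamily p q Obs ν) (P : Measure Ω) (Y : ℕ → Ω → Obs)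
    (A : Finset (Fin q)) (bhat : ℕ → Ω → SubParam p A) : Prop where
  aemeasurable : ∀ n, AEMeasurable (bhat n) P
  isMaxOn : Tendsto (fun n => P {ω | ¬ (bhat n ω ∈ F.Θ A ∧
    IsMaxOn (F.logLik A n fun i => Y i ω) (F.Θ A) (bhat n ω))}) atTop (𝓝 0)

/-- `b` is a pseudo-true parameter of the model `A`: it solves `E S(b) = 0` for the score
function `S` of every sample size. -/
structure IsPseudoTrue (F : ModelFamily p q Obs ν) (P : Measure Ω) (Y : ℕ → Ω → Obs)
    (A : Finset (Fin q)) (b : SubParam p A) : Prop where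
  mem : b ∈ F.Θ A
  integral_score_eq_zero : ∀ n, ∫ ω, F.totalScore A n (fun i => Y i ω) b ∂P = 0

/-- The regularity conditions on the likelihood of the model `A`, around its pseudo-true
parameter `bs`. -/
structure Regular (F : ModelFamily p q Obs ν) (P : Measure Ω) (Y : ℕ → Ω → Obs)
    (A : Finset (Fin q)) (bs : SubParam p A) : Prop where
  /-- The log-likelihood of each observation is continuously differentiable. -/
  differentiableAt : ∀ i, ∀ y ∈ F.supp i, ∀ b ∈ F.Θ A, DifferentiableAt ℝ (F.logDensity A i y) b
  continuousOn_score : ∀ i, ∀ y ∈ F.supp i, ContinuousOn (F.score A i y) (F.Θ A)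
  /-- The score is locally bounded by functions whose expectations are bounded on average. -/
  score_dominated : ∀ b ∈ F.Θ A, ∃ r > 0, ∃ B : ℕ → Obs → ℝ, ∃ K : ℝ,
    (∀ i, Measurable (B i)) ∧ (∀ i, Integrable (fun ω => B i (Y i ω)) P) ∧
    (∀ i, ∀ y ∈ F.supp i, ∀ t ∈ Metric.ball b r, t ∈ F.Θ A ∧ ‖F.score A i y t‖ ≤ B i y) ∧
    ∀ n : ℕ, ∑ i ∈ Finset.range n, ∫ ω, B i (Y i ω) ∂P ≤ K * n
  /-- The score at `bs` has finite second moments, bounded on average. -/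
  memLp_score : ∀ i, MemLp (fun ω => F.score A i (Y i ω) bs) 2 P
  score_sq_bounded : ∃ V : ℝ, ∀ n : ℕ,
    ∑ i ∈ Finset.range n, ∫ ω, ‖F.score A i (Y i ω) bs‖ ^ 2 ∂P ≤ V * n
  /-- The Hessians at `bs` are uniformly integrable. -/
  hess_uniformIntegrable : UniformIntegrable (fun i ω => F.hess A i (Y i ω) bs) 1 P
  /-- The Hessian exists near `bs` and is continuous at `bs`, on average over the observations. -/
  hess_continuous : ∀ η > 0, ∃ r > 0, ∃ D : ℕ → Obs → ℝ,
    (∀ i, Measurable (D i)) ∧ (∀ i, Integrable (fun ω => D i (Y i ω)) P) ∧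
    (∀ i, ∀ y ∈ F.supp i, ∀ t ∈ Metric.ball bs r, t ∈ F.Θ A ∧
      DifferentiableAt ℝ (F.score A i y) t ∧ ‖F.hess A i y t - F.hess A i y bs‖ ≤ D i y) ∧
    ∀ᶠ n : ℕ in atTop, ∑ i ∈ Finset.range n, ∫ ω, D i (Y i ω) ∂P ≤ η * n
  /-- Identifiability: the log-likelihood ratios are uniformly integrable and the limit of their
  average expectation is negative, so that `bs` is the only maximizer of the limiting expected
  log-likelihood. -/
  logDensity_uniformIntegrable : ∀ b ∈ F.Θ A, UniformIntegrable
    (fun i ω => F.logDensity A i (Y i ω) b - F.logDensity A i (Y i ω) bs) 1 P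
  identifiable : ∀ b ∈ F.Θ A, b ≠ bs → ∃ m < 0, Tendsto (fun n : ℕ => (n : ℝ)⁻¹ *
    ∑ i ∈ Finset.range n, ∫ ω, (F.logDensity A i (Y i ω) b - F.logDensity A i (Y i ω) bs) ∂P)
    atTop (𝓝 m)
  /-- Far out in the parameter space the likelihood is smaller than at `bs`, with probability
  tending to one. -/
  coercive : ∃ K ⊆ F.Θ A, IsCompact K ∧ Tendsto (fun n => P {ω | ∃ b ∈ F.Θ A \ K,
    F.logLik A n (fun i => Y i ω) bs ≤ F.logLik A n (fun i => Y i ω) b}) atTop (𝓝 0)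

/-- `H` is the limit of the average expected Hessian at `bs`. As a linear equivalence, `H` is
invertible. -/
def IsLimitHessian (F : ModelFamily p q Obs ν) (P : Measure Ω) (Y : ℕ → Ω → Obs)
    (A : Finset (Fin q)) (bs : SubParam p A) (H : SubParam p A ≃L[ℝ] SubParam p A) : Prop :=
  Tendsto (fun n : ℕ => (n : ℝ)⁻¹ • ∑ i ∈ Finset.range n, ∫ ω, F.hess A i (Y i ω) bs ∂P)
    atTop (𝓝 (H : SubParam p A →L[ℝ] SubParam p A))

/-- The vector `∇μ(β̃*) H⁻¹ ℓ'(β*)` for the observation `y` with index `i` in the model `A`. The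
Jacobian of `μ` at the augmented parameter acts on the vector `H⁻¹ ℓ'(β*)`, whose missing
components are zero, so that only the partial derivatives in the components of `A` matter. -/
noncomputable def influence (F : ModelFamily p q Obs ν) {l : ℕ}
    (μ : FullParam p q → EuclideanSpace ℝ (Fin l)) (A : Finset (Fin q)) (c : Fin q → ℝ)
    (bs : SubParam p A) (H : SubParam p A ≃L[ℝ] SubParam p A) (i : ℕ) (y : Obs) :
    EuclideanSpace ℝ (Fin l) :=
  fderiv ℝ μ (augment c bs) (augment 0 (H.symm (F.score A i y bs)))

/-- The largest norm of the vectors `influence` over the candidate models. -/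
noncomputable def maxInfluence (F : ModelFamily p q Obs ν) {l : ℕ}
    (μ : FullParam p q → EuclideanSpace ℝ (Fin l)) (M : Finset (Finset (Fin q)))
    (c : Finset (Fin q) → Fin q → ℝ) (bs : ∀ A : Finset (Fin q), SubParam p A)
    (H : ∀ A : Finset (Fin q), SubParam p A ≃L[ℝ] SubParam p A) (i : ℕ) (y : Obs) : ℝ :=
  ((M.sup fun A => ‖F.influence μ A (c A) (bs A) (H A) i y‖₊ : NNReal) : ℝ)

/-- The Lindeberg-type condition on the candidate models. -/
def LindebergCondition (F : ModelFamily p q Obs ν) (P : Measure Ω) (Y : ℕ → Ω → Obs) {l : ℕ}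
    (μ : FullParam p q → EuclideanSpace ℝ (Fin l)) (M : Finset (Finset (Fin q)))
    (c : Finset (Fin q) → Fin q → ℝ) (bs : ∀ A : Finset (Fin q), SubParam p A)
    (H : ∀ A : Finset (Fin q), SubParam p A ≃L[ℝ] SubParam p A) : Prop :=
  ∀ ε > 0, Tendsto (fun n : ℕ => (n : ℝ)⁻¹ * ∑ i ∈ Finset.range n,
    ∫ ω, {ω' | √n * ε < F.maxInfluence μ M c bs H i (Y i ω')}.indicator
      (fun ω' => F.maxInfluence μ M c bs H i (Y i ω') ^ 2) ω ∂P) atTop (𝓝 0)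

/-- `S` is the limit of the averages of the second moment matrices of the weighted sums of the
vectors `influence`. -/
def IsLimitVariance (F : ModelFamily p q Obs ν) (P : Measure Ω) (Y : ℕ → Ω → Obs) {l : ℕ}
    (μ : FullParam p q → EuclideanSpace ℝ (Fin l)) (M : Finset (Finset (Fin q)))
    (w : Finset (Fin q) → ℝ) (c : Finset (Fin q) → Fin q → ℝ)
    (bs : ∀ A : Finset (Fin q), SubParam p A)
    (H : ∀ A : Finset (Fin q), SubParam p A ≃L[ℝ] SubParam p A)
    (S : Matrix (Fin l) (Fin l) ℝ) : Prop :=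
  ∀ r s : Fin l, Tendsto (fun n : ℕ => (n : ℝ)⁻¹ * ∑ i ∈ Finset.range n,
    ∫ ω, (∑ A ∈ M, w A • F.influence μ A (c A) (bs A) (H A) i (Y i ω)) r *
      (∑ A ∈ M, w A • F.influence μ A (c A) (bs A) (H A) i (Y i ω)) s ∂P) atTop (𝓝 (S r s))

end ModelFamily

/-! ### The Lindeberg central limit theorem -/

section Lindeberg

/-! Each estimator, whether or not its model is correct, is asymptotically a normalized sum of
independent terms, and all these sums use the same observations. Expanding the score equation around
β* gives √n(β̂ − β*) = −H⁻¹S(β*)/√n + o_P(1), and differentiability of μ turns this into √n(μ(β̂) −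
μ(β*)) = −n^(-1/2) ∑ Z_{k;i} + o_P(1) for every model k
(`IsMLE.tendsto_measure_sqrt_smul_sub_add_sum_influence`). In the weighted average μ(βtrue) cancels,
and what remains is the single sum −n^(-1/2) ∑_i ∑_k w_k Z_{k;i}. Its terms are independent and
centred, and as convex combinations they are bounded by max_k ‖Z_{k;i}‖, so (A1) yields Lindeberg's
condition. The central limit theorem `tendstoInDistribution_of_lindeberg` and Slutsky's lemma finish
the proof.

The expansion needs three facts. Consistency (`IsMLE.tendsto_measure_norm_sub_ge`) is Wald's
argument: a law of large numbers at finitely many parameters, a Lipschitz bound between them, and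
coercivity far out. The mean value inequality for the score and the law of large numbers for the
Hessians leave an error that is o_P(‖β̂ − β*‖) (`tendsto_measure_linearized_score`). Invertibility
of H absorbs this error and gives √n(β̂ − β*) = O_P(1)
(`IsMLE.exists_measure_sqrt_mul_norm_sub_gt_le`), so the error is negligible even after scaling by
√n.

Both limit theorems are proved for independent, not identically distributed terms: Lindeberg's by
characteristic functions, the weak law by truncation. -/

lemma norm_cexp_sub_taylor_le {ε : ℝ} (hε : 0 < ε) (hε1 : ε ≤ 1) (x : ℝ) :
    ‖Complex.exp (x * Complex.I) - (1 + x * Complex.I - x ^ 2 / 2)‖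
      ≤ 3 * ε * x ^ 2 + 5 * {y : ℝ | ε < |y|}.indicator (fun y => y ^ 2) x := by
  have small : |x| ≤ 1 →
      ‖Complex.exp (x * Complex.I) - (1 + x * Complex.I - x ^ 2 / 2)‖ ≤ 3 * |x| * x ^ 2 := by
    intro hx
    have h := Complex.norm_exp_sub_sum_le_norm_mul_exp (x * Complex.I) 3
    have e : ∑ m ∈ Finset.range 3, ((x : ℂ) * Complex.I) ^ m / (m.factorial : ℂ)
        = 1 + x * Complex.I - x ^ 2 / 2 := by
      simp only [Finset.sum_range_succ, Finset.sum_range_zero, Nat.factorial]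
      have : ((x : ℂ) * Complex.I) ^ 2 = -x ^ 2 := by rw [mul_pow, Complex.I_sq]; ring
      rw [this]
      push_cast
      ring
    rw [e] at h
    have hn : ‖(x : ℂ) * Complex.I‖ = |x| := by simp
    rw [hn] at h
    have h3 : Real.exp |x| ≤ 3 := by
      have := Real.exp_le_exp.2 hx
      have h2 := Real.exp_one_lt_d9
      linarith
    calc _ ≤ |x| ^ 3 * Real.exp |x| := h
      _ ≤ |x| ^ 3 * 3 := by gcongr
      _ = 3 * |x| * x ^ 2 := by rw [← sq_abs x]; ring
  by_cases hx : ε < |x|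
  · rw [Set.indicator_of_mem (show x ∈ {y : ℝ | ε < |y|} from hx)]
    -- Beyond ε only the order x² matters: the cubic bound is at most 3x² for |x| ≤ 1, and the
    -- triangle inequality gives 2 + |x| + x²/2 ≤ 7x²/2 for larger |x|.
    have key : ‖Complex.exp (x * Complex.I) - (1 + x * Complex.I - x ^ 2 / 2)‖ ≤ 5 * x ^ 2 := by
      by_cases hx1 : |x| ≤ 1
      · refine (small hx1).trans ?_
        nlinarith [sq_nonneg x]
      · push Not at hx1
        have h1 : ‖Complex.exp (x * Complex.I)‖ = 1 := Complex.norm_exp_ofReal_mul_I x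
        have h2 : ‖(x : ℂ) * Complex.I‖ = |x| := by simp
        have h3 : ‖(x : ℂ) ^ 2 / 2‖ = x ^ 2 / 2 := by simp
        have h4 : |x| ≤ x ^ 2 := by rw [← sq_abs x]; nlinarith
        calc _ ≤ ‖Complex.exp (x * Complex.I)‖ + ‖1 + (x : ℂ) * Complex.I - x ^ 2 / 2‖ :=
              norm_sub_le _ _
          _ ≤ ‖Complex.exp (x * Complex.I)‖ +
              (‖(1 : ℂ)‖ + ‖(x : ℂ) * Complex.I‖ + ‖(x : ℂ) ^ 2 / 2‖) := by
                gcongr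
                exact (norm_sub_le _ _).trans (by gcongr; exact norm_add_le _ _)
          _ ≤ 5 * x ^ 2 := by
                rw [h1, h2, h3, norm_one]
                linarith
    have : 0 ≤ 3 * ε * x ^ 2 := by positivity
    linarith
  · rw [Set.indicator_of_notMem (show x ∉ {y : ℝ | ε < |y|} from hx)]
    push Not at hx
    refine (small (hx.trans hε1)).trans ?_
    have := sq_nonneg x
    nlinarith

lemma abs_exp_neg_sub_le {x : ℝ} (hx : 0 ≤ x) : |Real.exp (-x) - (1 - x)| ≤ x ^ 2 / 2 := by
  have h1 : 1 - x ≤ Real.exp (-x) := by linarith [Real.add_one_le_exp (-x)]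
  have h2 := Real.quadratic_le_exp_of_nonneg hx
  have h3 : Real.exp (-x) * Real.exp x = 1 := by rw [← Real.exp_add]; simp
  rw [abs_of_nonneg (by linarith)]
  have h4 := Real.exp_pos (-x)
  have h5 : 0 ≤ 1 - x + x ^ 2 / 2 := by nlinarith [sq_nonneg (x - 1)]
  have h6 : Real.exp (-x) * (1 + x + x ^ 2 / 2) ≤ 1 := by
    calc _ ≤ Real.exp (-x) * Real.exp x := by gcongr
      _ = 1 := h3
  -- The product (1 − x + x²/2)(1 + x + x²/2) equals 1 + x⁴/4, hence is at least 1.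
  by_contra! h
  have h7 : (1 - x + x ^ 2 / 2) * (1 + x + x ^ 2 / 2) < Real.exp (-x) * (1 + x + x ^ 2 / 2) := by
    apply mul_lt_mul_of_pos_right (by linarith) (by positivity)
  nlinarith [sq_nonneg (x ^ 2)]

variable {Ω : Type*} [MeasurableSpace Ω] {P : Measure Ω} [IsProbabilityMeasure P]

/-- Both the characteristic function and its Gaussian counterpart are compared with 1 − s/2, where s
= E X². The first two error terms come from Taylor's formula for the centred X, the last one from
expanding exp(−s/2). -/
lemma norm_integral_cexp_sub_le {X : Ω → ℝ} (hX : MemLp X 2 P) (hX0 : ∫ ω, X ω ∂P = 0)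
    {ε : ℝ} (hε : 0 < ε) (hε1 : ε ≤ 1) :
    ‖(∫ ω, Complex.exp (X ω * Complex.I) ∂P) - (Real.exp (-(∫ ω, X ω ^ 2 ∂P) / 2) : ℝ)‖
      ≤ 3 * ε * (∫ ω, X ω ^ 2 ∂P)
        + 5 * (∫ ω, {y : ℝ | ε < |y|}.indicator (fun y => y ^ 2) (X ω) ∂P)
        + (∫ ω, X ω ^ 2 ∂P) *
          (ε ^ 2 + ∫ ω, {y : ℝ | ε < |y|}.indicator (fun y => y ^ 2) (X ω) ∂P) := by
  have hm : AEMeasurable X P := hX.1.aemeasurable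
  have hsq : Integrable (fun ω => X ω ^ 2) P := hX.integrable_sq
  have hi : Integrable X P := hX.integrable (by norm_num)
  have hind : Integrable (fun ω => {y : ℝ | ε < |y|}.indicator (fun y => y ^ 2) (X ω)) P := by
    refine hsq.mono' ?_ (ae_of_all _ fun ω => ?_)
    · have hpow : Measurable fun y : ℝ => y ^ 2 := by fun_prop
      exact ((hpow.indicator (measurableSet_lt measurable_const
        (by fun_prop))).comp_aemeasurable hm).aestronglyMeasurable
    · rw [Set.indicator_apply]
      split_ifs <;> simp [sq_nonneg]
  have hexp : Integrable (fun ω => Complex.exp (X ω * Complex.I)) P := by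
    refine (integrable_const (1 : ℝ)).mono' ?_ (ae_of_all _ fun ω => ?_)
    · exact (Measurable.comp_aemeasurable (g := fun y : ℝ => Complex.exp (y * Complex.I))
        (by fun_prop) hm).aestronglyMeasurable
    · rw [Complex.norm_exp_ofReal_mul_I]
  have hpoly : Integrable (fun ω => (1 + X ω * Complex.I - X ω ^ 2 / 2 : ℂ)) P := by
    refine ((integrable_const _).add (hi.ofReal.mul_const _)).sub ?_
    have := (hsq.ofReal (𝕜 := ℂ)).div_const 2
    simpa using this
  have hpolyI : ∫ ω, (1 + X ω * Complex.I - X ω ^ 2 / 2 : ℂ) ∂P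
      = ((1 - (∫ ω, X ω ^ 2 ∂P) / 2 : ℝ) : ℂ) := by
    have hs : Integrable (fun ω => (X ω : ℂ) ^ 2 / 2) P := by
      have := (hsq.ofReal (𝕜 := ℂ)).div_const 2
      simpa using this
    have hl : Integrable (fun ω => (1 + X ω * Complex.I : ℂ)) P :=
      (integrable_const _).add (hi.ofReal.mul_const _)
    rw [integral_sub hl hs,
      integral_add (integrable_const _) (hi.ofReal.mul_const _), integral_mul_const,
      integral_div]
    have e1 : ∫ ω, (X ω : ℂ) ∂P = 0 := by
      have := integral_ofReal (μ := P) (f := X) (𝕜 := ℂ)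
      rw [hX0] at this
      simpa using this
    have e2 : ∫ ω, (X ω : ℂ) ^ 2 ∂P = ((∫ ω, X ω ^ 2 ∂P : ℝ) : ℂ) := by
      have := integral_ofReal (μ := P) (f := fun ω => X ω ^ 2) (𝕜 := ℂ)
      simpa using this
    rw [e1, e2]
    simp
  set s := ∫ ω, X ω ^ 2 ∂P with hs
  set L := ∫ ω, {y : ℝ | ε < |y|}.indicator (fun y => y ^ 2) (X ω) ∂P with hL
  have hs0 : 0 ≤ s := integral_nonneg fun ω => sq_nonneg _
  have h1 : ‖(∫ ω, Complex.exp (X ω * Complex.I) ∂P) - ((1 - s / 2 : ℝ) : ℂ)‖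
      ≤ 3 * ε * s + 5 * L := by
    rw [← hpolyI, ← integral_sub hexp hpoly]
    have hsum : Integrable (fun ω => 3 * ε * X ω ^ 2
        + 5 * {y : ℝ | ε < |y|}.indicator (fun y => y ^ 2) (X ω)) P :=
      (hsq.const_mul (3 * ε)).add (hind.const_mul 5)
    refine (norm_integral_le_of_norm_le hsum
      (ae_of_all _ fun ω => norm_cexp_sub_taylor_le hε hε1 (X ω))).trans ?_
    rw [integral_add (hsq.const_mul (3 * ε)) (hind.const_mul 5), integral_const_mul,
      integral_const_mul]
  have h2 : ‖((1 - s / 2 : ℝ) : ℂ) - (Real.exp (-s / 2) : ℝ)‖ ≤ s * (ε ^ 2 + L) := by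
    rw [← Complex.ofReal_sub, Complex.norm_real, Real.norm_eq_abs, abs_sub_comm]
    have := abs_exp_neg_sub_le (x := s / 2) (by positivity)
    rw [neg_div]
    refine this.trans ?_
    -- Splitting at |X| = ε bounds one of the two factors of s²; this makes the quadratic error
    -- summable over the array.
    have hsL : s ≤ ε ^ 2 + L := by
      have : s ≤ ∫ ω, (ε ^ 2 + {y : ℝ | ε < |y|}.indicator (fun y => y ^ 2) (X ω)) ∂P := by
        refine integral_mono hsq ((integrable_const _).add hind) fun ω => ?_
        by_cases h : ε < |X ω|
        · simp only [Set.indicator_of_mem (show X ω ∈ {y : ℝ | ε < |y|} from h)]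
          nlinarith [sq_nonneg ε]
        · simp only [Set.indicator_of_notMem (show X ω ∉ {y : ℝ | ε < |y|} from h)]
          push Not at h
          rw [← sq_abs (X ω)]
          have := abs_nonneg (X ω)
          nlinarith
      rw [integral_add (integrable_const _) hind] at this
      simpa using this
    nlinarith
  calc _ = ‖((∫ ω, Complex.exp (X ω * Complex.I) ∂P) - ((1 - s / 2 : ℝ) : ℂ))
        + (((1 - s / 2 : ℝ) : ℂ) - (Real.exp (-s / 2) : ℝ))‖ := by congr 1; ring
    _ ≤ _ := (norm_add_le _ _).trans (add_le_add h1 h2)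

/-- Exchange the factors one at a time; the untouched ones have norm at most 1. -/
lemma norm_prod_sub_prod_le_sum {ι : Type*} (s : Finset ι) (a b : ι → ℂ)
    (ha : ∀ i ∈ s, ‖a i‖ ≤ 1) (hb : ∀ i ∈ s, ‖b i‖ ≤ 1) :
    ‖∏ i ∈ s, a i - ∏ i ∈ s, b i‖ ≤ ∑ i ∈ s, ‖a i - b i‖ := by
  classical
  induction s using Finset.induction_on with
  | empty => simp
  | insert j s hj ih =>
    rw [Finset.prod_insert hj, Finset.prod_insert hj, Finset.sum_insert hj]
    have h1 := ih (fun i hi => ha i (Finset.mem_insert_of_mem hi))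
      (fun i hi => hb i (Finset.mem_insert_of_mem hi))
    have h2 : ‖∏ i ∈ s, b i‖ ≤ 1 := by
      rw [norm_prod]
      exact Finset.prod_le_one (fun _ _ => norm_nonneg _)
        fun i hi => hb i (Finset.mem_insert_of_mem hi)
    have h3 := ha j (Finset.mem_insert_self _ _)
    calc ‖a j * ∏ i ∈ s, a i - b j * ∏ i ∈ s, b i‖
        = ‖(a j - b j) * ∏ i ∈ s, b i + a j * (∏ i ∈ s, a i - ∏ i ∈ s, b i)‖ := by
          congr 1; ring
      _ ≤ ‖a j - b j‖ * ‖∏ i ∈ s, b i‖ + ‖a j‖ * ‖∏ i ∈ s, a i - ∏ i ∈ s, b i‖ := by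
          refine (norm_add_le _ _).trans ?_
          rw [norm_mul, norm_mul]
      _ ≤ ‖a j - b j‖ * 1 + 1 * ∑ i ∈ s, ‖a i - b i‖ := by gcongr
      _ = _ := by ring

/-- Under the Lindeberg condition, the products of the characteristic functions of the summands
(at a fixed argument, which is absorbed into `X`) converge to a Gaussian characteristic function. -/
lemma tendsto_prod_integral_cexp {X : ℕ → Ω → ℝ} (hX : ∀ i, MemLp (X i) 2 P)
    (hX0 : ∀ i, ∫ ω, X i ω ∂P = 0) {v : ℝ}
    (hv : Tendsto (fun n : ℕ => (n : ℝ)⁻¹ * ∑ i ∈ Finset.range n, ∫ ω, X i ω ^ 2 ∂P) atTop (𝓝 v))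
    (hL : ∀ ε > 0, Tendsto (fun n : ℕ => (n : ℝ)⁻¹ * ∑ i ∈ Finset.range n,
      ∫ ω, {y : ℝ | √n * ε < |y|}.indicator (fun y => y ^ 2) (X i ω) ∂P) atTop (𝓝 0)) :
    Tendsto (fun n : ℕ => ∏ i ∈ Finset.range n,
      ∫ ω, Complex.exp (((√n)⁻¹ * X i ω : ℝ) * Complex.I) ∂P) atTop
      (𝓝 (Real.exp (-v / 2) : ℝ)) := by
  set T : ℕ → ℝ := fun n => (n : ℝ)⁻¹ * ∑ i ∈ Finset.range n, ∫ ω, X i ω ^ 2 ∂P with hT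
  have hlim : Tendsto (fun n => ((Real.exp (-T n / 2) : ℝ) : ℂ)) atTop
      (𝓝 (Real.exp (-v / 2) : ℝ)) := by
    refine (Complex.continuous_ofReal.tendsto _).comp ?_
    exact (Real.continuous_exp.tendsto _).comp ((hv.neg).div_const 2)
  have hv0 : 0 ≤ v := ge_of_tendsto' hv fun n =>
    mul_nonneg (by positivity) (Finset.sum_nonneg fun i _ => integral_nonneg fun ω => sq_nonneg _)
  suffices hd : Tendsto (fun n : ℕ => (∏ i ∈ Finset.range n,
      ∫ ω, Complex.exp (((√n)⁻¹ * X i ω : ℝ) * Complex.I) ∂P)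
      - ((Real.exp (-T n / 2) : ℝ) : ℂ)) atTop (𝓝 0) by
    simpa using hd.add hlim
  rw [Metric.tendsto_atTop']
  intro δ hδ
  -- The quantity 3εv + vε² is the limit of the error bound below, once the Lindeberg sums have
  -- vanished.
  obtain ⟨ε, hε, hε1, hεδ⟩ : ∃ ε : ℝ, 0 < ε ∧ ε ≤ 1 ∧ 3 * ε * v + v * ε ^ 2 < δ := by
    refine ⟨min 1 (δ / (8 * (v + 1))), by positivity, min_le_left _ _, ?_⟩
    set e := min 1 (δ / (8 * (v + 1)))
    have he0 : 0 < e := by positivity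
    have he1 : e ≤ 1 := min_le_left _ _
    have he2 : e * (8 * (v + 1)) ≤ δ := by
      have : e ≤ δ / (8 * (v + 1)) := min_le_right _ _
      rwa [le_div_iff₀ (by positivity)] at this
    have : v * e ^ 2 ≤ v * e := by
      apply mul_le_mul_of_nonneg_left _ hv0
      nlinarith
    nlinarith [mul_nonneg he0.le hv0]
  set Λ : ℕ → ℝ := fun n => (n : ℝ)⁻¹ * ∑ i ∈ Finset.range n,
      ∫ ω, {y : ℝ | √n * ε < |y|}.indicator (fun y => y ^ 2) (X i ω) ∂P with hΛ
  have hΛ0 := hL ε hε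
  have hbound : ∀ n : ℕ, 0 < n → ‖(∏ i ∈ Finset.range n,
      ∫ ω, Complex.exp (((√n)⁻¹ * X i ω : ℝ) * Complex.I) ∂P)
      - ((Real.exp (-T n / 2) : ℝ) : ℂ)‖
      ≤ 3 * ε * T n + 5 * Λ n + T n * (ε ^ 2 + Λ n) := by
    intro n hn
    have hsn : 0 < √(n : ℝ) := Real.sqrt_pos.2 (by exact_mod_cast hn)
    set Z : ℕ → Ω → ℝ := fun i ω => (√n)⁻¹ * X i ω with hZ
    have hsqn : ((√(n : ℝ))⁻¹) ^ 2 = (n : ℝ)⁻¹ := by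
      rw [inv_pow, Real.sq_sqrt (Nat.cast_nonneg n)]
    have hs : ∀ i, ∫ ω, Z i ω ^ 2 ∂P = (n : ℝ)⁻¹ * ∫ ω, X i ω ^ 2 ∂P := by
      intro i
      rw [← integral_const_mul]
      congr 1
      ext ω
      simp only [hZ, mul_pow, hsqn]
    have hl : ∀ i, ∫ ω, {y : ℝ | ε < |y|}.indicator (fun y => y ^ 2) (Z i ω) ∂P
        = (n : ℝ)⁻¹ * ∫ ω, {y : ℝ | √n * ε < |y|}.indicator (fun y => y ^ 2) (X i ω) ∂P := by
      intro i
      rw [← integral_const_mul]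
      congr 1
      ext ω
      have : ε < |Z i ω| ↔ √n * ε < |X i ω| := by
        simp only [hZ, abs_mul, abs_inv, abs_of_pos hsn]
        rw [inv_mul_eq_div, lt_div_iff₀ hsn, mul_comm]
      simp only [Set.indicator_apply, Set.mem_ofPred_eq, this]
      split_ifs
      · simp only [hZ, mul_pow, hsqn]
      · simp
    have hTn : T n = ∑ i ∈ Finset.range n, ∫ ω, Z i ω ^ 2 ∂P := by
      simp only [hT, hs, Finset.mul_sum]
    have hΛn : Λ n = ∑ i ∈ Finset.range n,
        ∫ ω, {y : ℝ | ε < |y|}.indicator (fun y => y ^ 2) (Z i ω) ∂P := by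
      simp only [hΛ, hl, Finset.mul_sum]
    have hprod : ((Real.exp (-T n / 2) : ℝ) : ℂ)
        = ∏ i ∈ Finset.range n, ((Real.exp (-(∫ ω, Z i ω ^ 2 ∂P) / 2) : ℝ) : ℂ) := by
      rw [← Complex.ofReal_prod, ← Real.exp_sum, hTn, ← Finset.sum_div, ← Finset.sum_neg_distrib]
    have hnonneg : ∀ i, 0 ≤ ∫ ω, Z i ω ^ 2 ∂P := fun i => integral_nonneg fun ω => sq_nonneg _
    have hlnonneg : ∀ i, 0 ≤ ∫ ω, {y : ℝ | ε < |y|}.indicator (fun y => y ^ 2) (Z i ω) ∂P :=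
      fun i => integral_nonneg fun ω => Set.indicator_nonneg (fun _ _ => sq_nonneg _) _
    rw [hprod]
    refine (norm_prod_sub_prod_le_sum _ _ _ (fun i _ => ?_) (fun i _ => ?_)).trans ?_
    · refine (norm_integral_le_of_norm_le_const (C := 1) (ae_of_all _ fun ω => ?_)).trans ?_
      · rw [Complex.norm_exp_ofReal_mul_I]
      · simp
    · rw [Complex.norm_real, Real.norm_eq_abs, abs_of_pos (Real.exp_pos _), Real.exp_le_one_iff]
      linarith [hnonneg i]
    · have hZ2 : ∀ i, MemLp (Z i) 2 P := fun i => (hX i).const_mul _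
      have hZ0 : ∀ i, ∫ ω, Z i ω ∂P = 0 := fun i => by
        simp only [hZ, integral_const_mul, hX0, mul_zero]
      refine (Finset.sum_le_sum fun i _ =>
        norm_integral_cexp_sub_le (hZ2 i) (hZ0 i) hε hε1).trans ?_
      -- A single truncated moment is at most the whole Lindeberg sum, so the factor ε² + Λ n can be
      -- taken out of the sum over i.
      have hle : ∀ i ∈ Finset.range n,
          ∫ ω, {y : ℝ | ε < |y|}.indicator (fun y => y ^ 2) (Z i ω) ∂P ≤ Λ n := by
        intro i hi
        rw [hΛn]
        exact Finset.single_le_sum (f := fun i =>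
          ∫ ω, {y : ℝ | ε < |y|}.indicator (fun y => y ^ 2) (Z i ω) ∂P)
          (fun i _ => hlnonneg i) hi
      calc _ ≤ ∑ i ∈ Finset.range n, (3 * ε * (∫ ω, Z i ω ^ 2 ∂P)
            + 5 * (∫ ω, {y : ℝ | ε < |y|}.indicator (fun y => y ^ 2) (Z i ω) ∂P)
            + (∫ ω, Z i ω ^ 2 ∂P) * (ε ^ 2 + Λ n)) := by
              refine Finset.sum_le_sum fun i hi => ?_
              have := mul_le_mul_of_nonneg_left (hle i hi) (hnonneg i)
              linarith
        _ = _ := by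
              rw [Finset.sum_add_distrib, Finset.sum_add_distrib, ← Finset.mul_sum,
                ← Finset.mul_sum, ← Finset.sum_mul, ← hTn, ← hΛn]
  have hR : Tendsto (fun n => 3 * ε * T n + 5 * Λ n + T n * (ε ^ 2 + Λ n)) atTop
      (𝓝 (3 * ε * v + 5 * 0 + v * (ε ^ 2 + 0))) :=
    ((hv.const_mul _).add (hΛ0.const_mul _)).add (hv.mul (hΛ0.const_add _))
  have hev := hR.eventually_lt_const (u := δ) (by simpa using hεδ)
  obtain ⟨N, hN⟩ := eventually_atTop.1 (hev.and (eventually_gt_atTop 0))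
  refine ⟨N, fun n hn => ?_⟩
  rw [dist_zero_right]
  exact (hbound n (hN n hn.le).2).trans_lt (hN n hn.le).1

/-- The **Lindeberg central limit theorem** for random vectors. -/
theorem tendstoInDistribution_of_lindeberg {ι : Type*} [Fintype ι] [DecidableEq ι]
    {X : ℕ → Ω → EuclideanSpace ℝ ι} (hX : ∀ i, MemLp (X i) 2 P) (hX0 : ∀ i, ∫ ω, X i ω ∂P = 0)
    (hindep : iIndepFun X P) {S : Matrix ι ι ℝ}
    (hS : ∀ r s, Tendsto (fun n : ℕ => (n : ℝ)⁻¹ * ∑ i ∈ Finset.range n,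
      ∫ ω, X i ω r * X i ω s ∂P) atTop (𝓝 (S r s)))
    (hL : ∀ ε > 0, Tendsto (fun n : ℕ => (n : ℝ)⁻¹ * ∑ i ∈ Finset.range n,
      ∫ ω, {y : EuclideanSpace ℝ ι | √n * ε < ‖y‖}.indicator (fun y => ‖y‖ ^ 2) (X i ω) ∂P)
      atTop (𝓝 0)) :
    TendstoInDistribution (fun (n : ℕ) ω => (√n)⁻¹ • ∑ i ∈ Finset.range n, X i ω) atTop id
      (fun _ => P) (multivariateGaussian 0 S) := by
  have hm : ∀ i, AEMeasurable (X i) P := fun i => (hX i).1.aemeasurable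
  have hcoord : ∀ i r, MemLp (fun ω => X i ω r) 2 P := fun i r =>
    (EuclideanSpace.proj (𝕜 := ℝ) r).comp_memLp' (hX i)
  have hquad : ∀ t : ι → ℝ, Tendsto (fun n : ℕ => (n : ℝ)⁻¹ * ∑ i ∈ Finset.range n,
      ∫ ω, (∑ r, X i ω r * t r) ^ 2 ∂P) atTop (𝓝 (t ⬝ᵥ S.mulVec t)) := by
    intro t
    have e : ∀ i, ∫ ω, (∑ r, X i ω r * t r) ^ 2 ∂P
        = ∑ r, ∑ s, t r * ((∫ ω, X i ω r * X i ω s ∂P) * t s) := by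
      intro i
      have hint : ∀ r s, Integrable (fun ω => X i ω r * t r * (X i ω s * t s)) P := fun r s =>
        ((hcoord i r).mul_const (t r)).integrable_mul ((hcoord i s).mul_const (t s))
      simp_rw [sq, Finset.sum_mul_sum]
      rw [integral_finsetSum _ fun r _ => integrable_finsetSum _ fun s _ => hint r s]
      refine Finset.sum_congr rfl fun r _ => ?_
      rw [integral_finsetSum _ fun s _ => hint r s]
      refine Finset.sum_congr rfl fun s _ => ?_
      rw [← integral_mul_const, ← integral_const_mul]
      congr 1
      ext ω
      ring
    have e2 : ∀ n : ℕ, (n : ℝ)⁻¹ * ∑ i ∈ Finset.range n, ∫ ω, (∑ r, X i ω r * t r) ^ 2 ∂P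
        = ∑ r, ∑ s, t r * (((n : ℝ)⁻¹ * ∑ i ∈ Finset.range n, ∫ ω, X i ω r * X i ω s ∂P)
          * t s) := by
      intro n
      simp_rw [e]
      rw [Finset.sum_comm, Finset.mul_sum]
      refine Finset.sum_congr rfl fun r _ => ?_
      rw [Finset.sum_comm, Finset.mul_sum]
      refine Finset.sum_congr rfl fun s _ => ?_
      rw [← Finset.mul_sum, ← Finset.sum_mul]
      ring
    have e3 : t ⬝ᵥ S.mulVec t = ∑ r, ∑ s, t r * (S r s * t s) := by
      simp only [dotProduct, Matrix.mulVec, Finset.mul_sum]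
    simp_rw [e2, e3]
    exact tendsto_finsetSum _ fun r _ => tendsto_finsetSum _ fun s _ =>
      ((hS r s).mul_const _).const_mul _
  -- The formula for the Gaussian characteristic function requires this; it is inherited from the
  -- second moment matrices. `S` may be singular.
  have hpos : S.PosSemidef := by
    refine Matrix.PosSemidef.of_dotProduct_mulVec_nonneg ?_ fun t => ?_
    · ext r s
      simp only [Matrix.conjTranspose_apply, star_trivial]
      refine tendsto_nhds_unique (hS s r) ?_
      simpa only [mul_comm] using hS r s
    · rw [star_trivial]
      exact ge_of_tendsto' (hquad t) fun n => mul_nonneg (by positivity)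
        (Finset.sum_nonneg fun i _ => integral_nonneg fun ω => sq_nonneg _)
  have hsm : ∀ n : ℕ, AEMeasurable (fun ω => (√n)⁻¹ • ∑ i ∈ Finset.range n, X i ω) P := fun n =>
    AEMeasurable.const_smul (g := fun ω => ∑ i ∈ Finset.range n, X i ω)
      (Finset.aemeasurable_fun_sum _ fun i _ => hm i) (√n)⁻¹
  refine ⟨hsm, aemeasurable_id, ?_⟩
  refine ProbabilityMeasure.tendsto_iff_tendsto_charFun.2 fun t => ?_
  have hlim : charFun ((multivariateGaussian 0 S).map id) t
      = ((Real.exp (-(t.ofLp ⬝ᵥ S.mulVec t.ofLp) / 2) : ℝ) : ℂ) := by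
    rw [Measure.map_id, charFun_multivariateGaussian hpos]
    simp [neg_div]
  have hinner : ∀ i ω, inner ℝ (X i ω) t = ∑ r, X i ω r * t r := by
    intro i ω
    simp [PiLp.inner_apply, mul_comm]
  have hchar : ∀ n : ℕ, charFun (P.map fun ω => (√n)⁻¹ • ∑ i ∈ Finset.range n, X i ω) t
      = ∏ i ∈ Finset.range n,
        ∫ ω, Complex.exp (((√n)⁻¹ * inner ℝ (X i ω) t : ℝ) * Complex.I) ∂P := by
    intro n
    have e : (fun ω => (√n)⁻¹ • ∑ i ∈ Finset.range n, X i ω)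
        = fun ω => ∑ i ∈ Finset.range n, (√n)⁻¹ • X i ω := by
      ext1 ω
      rw [Finset.smul_sum]
    have hsi : ∀ i, AEMeasurable (fun ω => (√n)⁻¹ • X i ω) P := fun i =>
      AEMeasurable.const_smul (g := X i) (hm i) (√n)⁻¹
    have hind : iIndepFun (fun i ω => (√n)⁻¹ • X i ω) P :=
      hindep.comp (fun _ y => (√n)⁻¹ • y) fun _ => measurable_const_smul _
    rw [e, iIndepFun.charFun_map_fun_finsetSum_eq_prod (X := fun i ω => (√n)⁻¹ • X i ω)
      (fun i _ => hsi i) (hind.precomp (g := ((↑) : Finset.range n → ℕ)) Subtype.val_injective), Finset.prod_apply]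
    refine Finset.prod_congr rfl fun i _ => ?_
    rw [charFun_apply, integral_map (hsi i) (by fun_prop)]
    simp_rw [inner_smul_left]
    simp
  have hmain := tendsto_prod_integral_cexp (P := P) (X := fun i ω => inner ℝ (X i ω) t)
    (v := t.ofLp ⬝ᵥ S.mulVec t.ofLp)
    (fun i => by
      have := (innerSL ℝ t).comp_memLp' (hX i)
      simpa [real_inner_comm, Function.comp_def] using this)
    (fun i => by
      have := integral_inner (𝕜 := ℝ) ((hX i).integrable (by norm_num)) t
      simpa only [hX0 i, inner_zero_right, real_inner_comm t] using this)
    (by simpa only [hinner] using hquad t.ofLp)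
    (fun ε hε => by
      -- By Cauchy–Schwarz a projection exceeding √n ε forces the vector to exceed √n ε / C. The
      -- added 1 keeps the division meaningful for t = 0.
      set C : ℝ := ‖t‖ + 1 with hC
      have hC0 : 0 < C := by positivity
      have hlimL := (hL (ε / C) (by positivity)).const_mul (C ^ 2)
      rw [mul_zero] at hlimL
      refine squeeze_zero (fun n => mul_nonneg (by positivity) (Finset.sum_nonneg fun i _ =>
        integral_nonneg fun ω => Set.indicator_nonneg (fun _ _ => sq_nonneg _) _)) (fun n => ?_)
        hlimL
      rw [mul_left_comm]
      refine mul_le_mul_of_nonneg_left ?_ (by positivity)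
      rw [Finset.mul_sum]
      refine Finset.sum_le_sum fun i _ => ?_
      rw [← integral_const_mul]
      refine integral_mono_of_nonneg
        (ae_of_all _ fun ω => Set.indicator_nonneg (fun _ _ => sq_nonneg _) _) ?_
        (ae_of_all _ fun ω => ?_)
      · refine Integrable.const_mul ((hX i).norm.integrable_sq.mono' ?_ (ae_of_all _ fun ω => ?_)) _
        · have hpow : Measurable fun y : EuclideanSpace ℝ ι => ‖y‖ ^ 2 := by fun_prop
          exact ((hpow.indicator (measurableSet_lt measurable_const
            (by fun_prop))).comp_aemeasurable (hm i)).aestronglyMeasurable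
        · rw [Set.indicator_apply]
          split_ifs <;> simp
      · have hle : |inner ℝ (X i ω) t| ≤ C * ‖X i ω‖ := by
          refine (abs_real_inner_le_norm _ _).trans ?_
          rw [mul_comm]
          gcongr
          simp [hC]
        simp only [Set.indicator_apply, Set.mem_ofPred_eq]
        split_ifs with h1 h2
        · rw [← mul_pow, ← sq_abs]
          gcongr
        · exfalso
          apply h2
          rw [← mul_div_assoc, div_lt_iff₀ hC0, mul_comm ‖X i ω‖]
          exact h1.trans_le hle
        · positivity
        · simp)
  simp only [ProbabilityMeasure.coe_mk]
  rw [hlim]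
  simp_rw [hchar]
  exact hmain

end Lindeberg

/-! ### A weak law of large numbers for uniformly integrable sequences -/

section WeakLaw

variable {Ω : Type*} [MeasurableSpace Ω] {P : Measure Ω}

lemma MeasureTheory.UniformIntegrable.clm_comp {ι V W : Type*} [NormedAddCommGroup V]
    [NormedSpace ℝ V] [NormedAddCommGroup W] [NormedSpace ℝ W] {X : ι → Ω → V} {r : ENNReal}
    (hX : UniformIntegrable X r P) (f : V →L[ℝ] W) :
    UniformIntegrable (fun i ω => f (X i ω)) r P := by
  have hbound : ∀ (s : Set Ω) i,
      eLpNorm (s.indicator fun ω => f (X i ω)) r P ≤ ‖f‖₊ • eLpNorm (s.indicator (X i)) r P := by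
    intro s i
    classical
    refine eLpNorm_le_nnreal_smul_eLpNorm_of_ae_le_mul (ae_of_all _ fun ω => ?_) r
    rw [Set.indicator_apply, Set.indicator_apply]
    split_ifs
    · exact f.le_opNNNorm _
    · simp
  obtain ⟨h1, h2, C, hC⟩ := hX
  refine ⟨fun i => f.continuous.comp_aestronglyMeasurable (h1 i), fun ε hε => ?_, ‖f‖₊ * C,
    fun i => ?_⟩
  · obtain ⟨δ, hδ, h⟩ := h2 (show 0 < ε / (‖f‖ + 1) by positivity)
    refine ⟨δ, hδ, fun i s hs hsδ => (hbound s i).trans ?_⟩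
    calc ‖f‖₊ • eLpNorm (s.indicator (X i)) r P
        ≤ ‖f‖₊ • ENNReal.ofReal (ε / (‖f‖ + 1)) := by gcongr; exact h i s hs hsδ
      _ = ENNReal.ofReal (‖f‖ * (ε / (‖f‖ + 1))) := by
          rw [ENNReal.ofReal_mul (norm_nonneg _), ENNReal.smul_def, smul_eq_mul, ofReal_norm]
          rfl
      _ ≤ ENNReal.ofReal ε := by
          apply ENNReal.ofReal_le_ofReal
          rw [mul_div_assoc', div_le_iff₀ (by positivity)]
          nlinarith [norm_nonneg f]
  · have := hbound Set.univ i
    simp only [Set.indicator_univ] at this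
    refine this.trans ?_
    rw [ENNReal.smul_def, smul_eq_mul, ENNReal.coe_mul]
    gcongr
    exact hC i

variable [IsProbabilityMeasure P]

lemma integral_average_sub_sq_le {Z : ℕ → Ω → ℝ} (hm : ∀ i, AEMeasurable (Z i) P) {C : ℝ}
    (hZ : ∀ i ω, |Z i ω| ≤ C) (hind : iIndepFun Z P) {n : ℕ} (hn : 0 < n) :
    ∫ ω, ((n : ℝ)⁻¹ * ∑ i ∈ Finset.range n, (Z i ω - ∫ ω', Z i ω' ∂P)) ^ 2 ∂P
      ≤ (n : ℝ)⁻¹ * C ^ 2 := by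
  have hL : ∀ i, MemLp (Z i) 2 P := fun i =>
    MemLp.of_bound (hm i).aestronglyMeasurable C (ae_of_all _ fun ω => hZ i ω)
  have hvar : Var[∑ i ∈ Finset.range n, Z i; P] ≤ n * C ^ 2 := by
    rw [IndepFun.variance_sum (fun i _ => hL i) fun i _ j _ hij => hind.indepFun hij]
    calc _ ≤ ∑ i ∈ Finset.range n, C ^ 2 := by
          refine Finset.sum_le_sum fun i _ => ?_
          refine (variance_le_expectation_sq (hL i).1).trans ?_
          calc _ ≤ ∫ ω, C ^ 2 ∂P := by
                refine integral_mono (hL i).integrable_sq (integrable_const _) fun ω => ?_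
                exact sq_le_sq' (abs_le.1 (hZ i ω)).1 (abs_le.1 (hZ i ω)).2
            _ = _ := by simp
      _ = _ := by simp
  rw [variance_eq_integral (Finset.aemeasurable_sum _ fun i _ => hm i)] at hvar
  have hE : ∫ ω, (∑ i ∈ Finset.range n, Z i) ω ∂P = ∑ i ∈ Finset.range n, ∫ ω, Z i ω ∂P := by
    simp only [Finset.sum_apply]
    exact integral_finsetSum _ fun i _ => (hL i).integrable (by norm_num)
  have e : ∀ ω, ((n : ℝ)⁻¹ * ∑ i ∈ Finset.range n, (Z i ω - ∫ ω', Z i ω' ∂P)) ^ 2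
      = ((n : ℝ)⁻¹) ^ 2 * ((∑ i ∈ Finset.range n, Z i) ω
        - ∫ ω', (∑ i ∈ Finset.range n, Z i) ω' ∂P) ^ 2 := by
    intro ω
    rw [← mul_pow, hE, Finset.sum_sub_distrib, Finset.sum_apply]
  simp_rw [e]
  rw [integral_const_mul]
  have hn0 : (0 : ℝ) < n := by exact_mod_cast hn
  calc _ ≤ ((n : ℝ)⁻¹) ^ 2 * (n * C ^ 2) := by gcongr
    _ = _ := by field_simp

/-- Truncate at a level C that uniform integrability provides for all indices at once. The tails
contribute at most 2ε in mean, and the average of the bounded parts has variance at most C²/n by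
independence. -/
theorem tendsto_integral_abs_average_sub {X : ℕ → Ω → ℝ} (hX : UniformIntegrable X 1 P)
    (hind : iIndepFun X P) :
    Tendsto (fun n : ℕ => ∫ ω, |(n : ℝ)⁻¹ * ∑ i ∈ Finset.range n, (X i ω - ∫ ω', X i ω' ∂P)| ∂P)
      atTop (𝓝 0) := by
  have hm : ∀ i, AEMeasurable (X i) P := fun i => (hX.1 i).aemeasurable
  have hint : ∀ i, Integrable (X i) P := fun i => memLp_one_iff_integrable.1 (hX.memLp i)
  have key : ∀ ε > 0, ∃ C : ℝ, ∀ n : ℕ, 0 < n →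
      ∫ ω, |(n : ℝ)⁻¹ * ∑ i ∈ Finset.range n, (X i ω - ∫ ω', X i ω' ∂P)| ∂P
        ≤ 3 * ε + (n : ℝ)⁻¹ * C := by
    intro ε hε
    obtain ⟨C, hC⟩ := hX.spec (by norm_num) (by norm_num) hε
    set K : Set ℝ := {x | C ≤ ‖x‖₊} with hK
    have hKm : MeasurableSet K := measurableSet_le measurable_const measurable_nnnorm
    set R : ℝ → ℝ := K.indicator id with hR
    set T : ℝ → ℝ := Kᶜ.indicator id with hT
    have hRm : Measurable R := measurable_id.indicator hKm
    have hTm : Measurable T := measurable_id.indicator hKm.compl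
    have hTR : ∀ x, T x + R x = x := fun x => Set.indicator_compl_add_self_apply K id x
    have hTb : ∀ x, |T x| ≤ C := by
      intro x
      simp only [hT, Set.indicator_apply, Set.mem_compl_iff, hK, Set.mem_ofPred_eq, not_le, id]
      split_ifs with h
      · have : ‖x‖ < C := by exact_mod_cast h
        exact this.le
      · simp
    have hTL : ∀ i, MemLp (fun ω => T (X i ω)) 2 P := fun i =>
      MemLp.of_bound (hTm.comp_aemeasurable (hm i)).aestronglyMeasurable C
        (ae_of_all _ fun ω => hTb _)
    have hTi : ∀ i, Integrable (fun ω => T (X i ω)) P := fun i => (hTL i).integrable (by norm_num)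
    have hRe : ∀ i ω, R (X i ω) = X i ω - T (X i ω) := fun i ω => by linarith [hTR (X i ω)]
    have hRi : ∀ i, Integrable (fun ω => R (X i ω)) P := fun i => by
      simp_rw [hRe]
      exact (hint i).sub (hTi i)
    have hRb : ∀ i, ∫ ω, |R (X i ω)| ∂P ≤ ε := by
      intro i
      have h := hC i
      have e : {x | C ≤ ‖X i x‖₊}.indicator (X i) = fun ω => R (X i ω) := by
        ext ω
        simp [hR, hK, Set.indicator_apply]
      rw [e, eLpNorm_one_eq_lintegral_enorm, ← ofReal_integral_norm_eq_lintegral_enorm (hRi i)] at h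
      exact (ENNReal.ofReal_le_ofReal_iff hε.le).1 h
    refine ⟨C ^ 2 / ε, fun n hn => ?_⟩
    have hn0 : (0 : ℝ) < n := by exact_mod_cast hn
    set U : Ω → ℝ := fun ω => (n : ℝ)⁻¹ * ∑ i ∈ Finset.range n, (T (X i ω) - ∫ ω', T (X i ω') ∂P)
      with hU
    set W : Ω → ℝ := fun ω => (n : ℝ)⁻¹ * ∑ i ∈ Finset.range n, (|R (X i ω)| + ε) with hW
    have hUL : MemLp U 2 P := by
      have : MemLp (fun ω => ∑ i ∈ Finset.range n, (T (X i ω) - ∫ ω', T (X i ω') ∂P)) 2 P :=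
        memLp_finsetSum _ fun i _ => (hTL i).sub (memLp_const _)
      exact this.const_mul _
    have hRε : ∀ i, Integrable (fun ω => |R (X i ω)| + ε) P := fun i =>
      (hRi i).abs.add (integrable_const _)
    have hWi : Integrable W P := (integrable_finsetSum _ fun i _ => hRε i).const_mul _
    have hUsq : ∫ ω, U ω ^ 2 ∂P ≤ (n : ℝ)⁻¹ * C ^ 2 :=
      integral_average_sub_sq_le (fun i => hTm.comp_aemeasurable (hm i)) (fun i ω => hTb _)
        (hind.comp (fun _ => T) fun _ => hTm) hn
    have hRle : ∀ i, |∫ ω, R (X i ω) ∂P| ≤ ε := fun i => (abs_integral_le_integral_abs).trans (hRb i)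
    -- The bound |U| ≤ ε + U²/ε converts the variance estimate into an L¹ estimate.
    have hpt : ∀ ω, |(n : ℝ)⁻¹ * ∑ i ∈ Finset.range n, (X i ω - ∫ ω', X i ω' ∂P)|
        ≤ (ε + U ω ^ 2 / ε) + W ω := by
      intro ω
      have e : (n : ℝ)⁻¹ * ∑ i ∈ Finset.range n, (X i ω - ∫ ω', X i ω' ∂P)
          = U ω + (n : ℝ)⁻¹ * ∑ i ∈ Finset.range n, (R (X i ω) - ∫ ω', R (X i ω') ∂P) := by
        simp only [hU]
        rw [← mul_add, ← Finset.sum_add_distrib]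
        congr 1
        refine Finset.sum_congr rfl fun i _ => ?_
        simp_rw [hRe]
        rw [integral_sub (hint i) (hTi i)]
        ring
      rw [e]
      refine (abs_add_le _ _).trans (add_le_add ?_ ?_)
      · rw [← sq_abs (U ω)]
        have h0 := abs_nonneg (U ω)
        rw [← sub_le_iff_le_add', le_div_iff₀ hε]
        nlinarith [sq_nonneg (|U ω| - ε), sq_nonneg (|U ω|)]
      · simp only [hW]
        rw [abs_mul, abs_of_pos (inv_pos.2 hn0)]
        gcongr
        refine (Finset.abs_sum_le_sum_abs _ _).trans (Finset.sum_le_sum fun i _ => ?_)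
        exact (abs_sub _ _).trans (add_le_add le_rfl (hRle i))
    have hUi : Integrable (fun ω => ε + U ω ^ 2 / ε) P :=
      (integrable_const _).add (hUL.integrable_sq.div_const _)
    calc _ ≤ ∫ ω, ((ε + U ω ^ 2 / ε) + W ω) ∂P :=
          integral_mono_of_nonneg (ae_of_all _ fun ω => abs_nonneg _) (hUi.add hWi)
            (ae_of_all _ hpt)
      _ = (ε + (∫ ω, U ω ^ 2 ∂P) / ε) + ∫ ω, W ω ∂P := by
          rw [integral_add hUi hWi,
            integral_add (integrable_const _) (hUL.integrable_sq.div_const _), integral_div]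
          simp
      _ ≤ (ε + ((n : ℝ)⁻¹ * C ^ 2) / ε) + 2 * ε := by
          gcongr
          simp only [hW]
          rw [integral_const_mul,
            integral_finsetSum _ fun i _ => hRε i]
          calc _ ≤ (n : ℝ)⁻¹ * ∑ i ∈ Finset.range n, (2 * ε) := by
                gcongr with i
                rw [integral_add (hRi i).abs (integrable_const _)]
                have := hRb i
                simp
                linarith
            _ = 2 * ε := by
                simp
                field_simp
      _ = _ := by ring
  rw [Metric.tendsto_atTop']
  intro δ hδ
  obtain ⟨C, hC⟩ := key (δ / 4) (by positivity)
  have hlim : Tendsto (fun n : ℕ => 3 * (δ / 4) + (n : ℝ)⁻¹ * C) atTop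
      (𝓝 (3 * (δ / 4) + 0 * C)) :=
    (tendsto_inv_atTop_nhds_zero_nat.mul_const _).const_add _
  have hev := hlim.eventually_lt_const (u := δ) (by linarith)
  obtain ⟨N, hN⟩ := eventually_atTop.1 (hev.and (eventually_gt_atTop 0))
  refine ⟨N, fun n hn => ?_⟩
  rw [dist_zero_right, Real.norm_eq_abs, abs_of_nonneg (integral_nonneg fun ω => abs_nonneg _)]
  exact (hC n (hN n hn.le).2).trans_lt (hN n hn.le).1

/-- The scalar law applies in each coordinate of a basis. Requiring independence only of scalar
images avoids choosing a σ-algebra on `V`, which for Hessians is a space of operators. -/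
theorem tendsto_integral_norm_average_sub {V : Type*} [NormedAddCommGroup V] [NormedSpace ℝ V]
    [FiniteDimensional ℝ V] {X : ℕ → Ω → V} (hX : UniformIntegrable X 1 P)
    (hind : ∀ f : V →L[ℝ] ℝ, iIndepFun (fun i ω => f (X i ω)) P) :
    Tendsto (fun n : ℕ => ∫ ω, ‖(n : ℝ)⁻¹ • ∑ i ∈ Finset.range n, (X i ω - ∫ ω', X i ω' ∂P)‖ ∂P)
      atTop (𝓝 0) := by
  have : CompleteSpace V := FiniteDimensional.complete ℝ V
  set b := Module.finBasis ℝ V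
  set f : Fin (Module.finrank ℝ V) → V →L[ℝ] ℝ := fun j => LinearMap.toContinuousLinearMap (b.coord j)
    with hf
  have hint : ∀ i, Integrable (X i) P := fun i => memLp_one_iff_integrable.1 (hX.memLp i)
  have hnorm : ∀ x : V, ‖x‖ ≤ ∑ j, |f j x| * ‖b j‖ := by
    intro x
    conv_lhs => rw [← b.sum_repr x]
    refine (norm_sum_le _ _).trans (Finset.sum_le_sum fun j _ => ?_)
    rw [norm_smul]
    rfl
  have hfj : ∀ j (n : ℕ) ω, f j ((n : ℝ)⁻¹ • ∑ i ∈ Finset.range n, (X i ω - ∫ ω', X i ω' ∂P))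
      = (n : ℝ)⁻¹ * ∑ i ∈ Finset.range n, (f j (X i ω) - ∫ ω', f j (X i ω') ∂P) := by
    intro j n ω
    rw [map_smul, map_sum, smul_eq_mul]
    congr 1
    refine Finset.sum_congr rfl fun i _ => ?_
    rw [map_sub, (f j).integral_comp_comm (hint i)]
  have hlim : Tendsto (fun n : ℕ => ∑ j, (∫ ω, |(n : ℝ)⁻¹ * ∑ i ∈ Finset.range n,
      (f j (X i ω) - ∫ ω', f j (X i ω') ∂P)| ∂P) * ‖b j‖) atTop (𝓝 (∑ j, 0 * ‖b j‖)) :=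
    tendsto_finsetSum _ fun j _ =>
      (tendsto_integral_abs_average_sub (hX.clm_comp (f j)) (hind (f j))).mul_const _
  simp only [zero_mul, Finset.sum_const_zero] at hlim
  refine squeeze_zero (fun n => integral_nonneg fun ω => norm_nonneg _) (fun n => ?_) hlim
  have hi : ∀ j, Integrable (fun ω => |(n : ℝ)⁻¹ * ∑ i ∈ Finset.range n,
      (f j (X i ω) - ∫ ω', f j (X i ω') ∂P)|) P := fun j =>
    ((integrable_finsetSum _ fun i _ =>
      ((f j).integrable_comp (hint i)).sub (integrable_const _)).const_mul _).abs
  simp_rw [← integral_mul_const]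
  rw [← integral_finsetSum _ fun j _ => (hi j).mul_const _]
  refine integral_mono_of_nonneg (ae_of_all _ fun ω => norm_nonneg _)
    (integrable_finsetSum _ fun j _ => (hi j).mul_const _) (ae_of_all _ fun ω => ?_)
  refine (hnorm _).trans (le_of_eq ?_)
  simp_rw [hfj]

end WeakLaw

/-! ### Events whose probability tends to zero -/

section Vanishing

variable {Ω : Type*} [MeasurableSpace Ω] {P : Measure Ω}

/-- The common form of the probabilistic estimates below: `C` collects events that vanish for fixed
ε, `D` a tightness or Markov event of probability at most ε. Inclusion almost everywhere suffices
because the regularity conditions hold only on the support. -/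
lemma tendsto_measure_zero_of_ae_imp_or {B : ℕ → Set Ω}
    (h : ∀ ε > 0, ∃ C D : ℕ → Set Ω, Tendsto (fun n => P (C n)) atTop (𝓝 0) ∧
      (∀ᶠ n in atTop, P (D n) ≤ ENNReal.ofReal ε) ∧
      ∀ᶠ n in atTop, ∀ᵐ ω ∂P, ω ∈ B n → ω ∈ C n ∨ ω ∈ D n) :
    Tendsto (fun n => P (B n)) atTop (𝓝 0) := by
  rw [ENNReal.tendsto_nhds_zero]
  intro ε hε
  rcases eq_or_ne ε ⊤ with rfl | hεt
  · simp
  have hε' : 0 < ε.toReal := ENNReal.toReal_pos hε.ne' hεt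
  obtain ⟨C, D, hC, hD, h⟩ := h (ε.toReal / 2) (by positivity)
  have hC' := ENNReal.tendsto_nhds_zero.1 hC (ENNReal.ofReal (ε.toReal / 2))
    (ENNReal.ofReal_pos.2 (by positivity))
  filter_upwards [hC', hD, h] with n h1 h2 h3
  calc P (B n) ≤ P (C n ∪ D n) := measure_mono_ae h3
    _ ≤ P (C n) + P (D n) := measure_union_le _ _
    _ ≤ ENNReal.ofReal (ε.toReal / 2) + ENNReal.ofReal (ε.toReal / 2) := add_le_add h1 h2
    _ = ε := by
      rw [← ENNReal.ofReal_add (by positivity) (by positivity), add_halves, ENNReal.ofReal_toReal hεt]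

lemma tendsto_measure_zero_of_ae_imp {B C : ℕ → Set Ω} (hC : Tendsto (fun n => P (C n)) atTop (𝓝 0))
    (h : ∀ᶠ n in atTop, ∀ᵐ ω ∂P, ω ∈ B n → ω ∈ C n) :
    Tendsto (fun n => P (B n)) atTop (𝓝 0) := by
  refine tendsto_measure_zero_of_ae_imp_or fun ε hε => ⟨C, fun _ => ∅, hC, by simp, ?_⟩
  filter_upwards [h] with n hn
  filter_upwards [hn] with ω hω hB using Or.inl (hω hB)

lemma tendsto_measure_union_zero {C D : ℕ → Set Ω} (hC : Tendsto (fun n => P (C n)) atTop (𝓝 0))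
    (hD : Tendsto (fun n => P (D n)) atTop (𝓝 0)) :
    Tendsto (fun n => P (C n ∪ D n)) atTop (𝓝 0) := by
  have := hC.add hD
  rw [add_zero] at this
  exact tendsto_of_tendsto_of_tendsto_of_le_of_le tendsto_const_nhds this (fun _ => zero_le)
    fun n => measure_union_le _ _

lemma tendsto_measure_biUnion_zero {ι : Type*} (t : Finset ι) {C : ι → ℕ → Set Ω}
    (hC : ∀ i ∈ t, Tendsto (fun n => P (C i n)) atTop (𝓝 0)) :
    Tendsto (fun n => P (⋃ i ∈ t, C i n)) atTop (𝓝 0) := by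
  have := tendsto_finsetSum t hC
  rw [Finset.sum_const_zero] at this
  exact tendsto_of_tendsto_of_tendsto_of_le_of_le tendsto_const_nhds this (fun _ => zero_le)
    fun n => measure_biUnion_finset_le _ _

lemma measure_le_setOf_le_ofReal [IsFiniteMeasure P] {f : Ω → ℝ} (hf : 0 ≤ᵐ[P] f)
    (hi : Integrable f P) {δ : ℝ} (hδ : 0 < δ) {C : ℝ} (hC : ∫ ω, f ω ∂P ≤ C) :
    P {ω | δ ≤ f ω} ≤ ENNReal.ofReal (C / δ) := by
  have h := (mul_meas_ge_le_integral_of_nonneg hf hi δ).trans hC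
  rw [mul_comm, ← le_div_iff₀ hδ] at h
  rw [← ofReal_measureReal]
  exact ENNReal.ofReal_le_ofReal h

lemma tendsto_measure_le_zero [IsFiniteMeasure P] {f : ℕ → Ω → ℝ} (hf : ∀ n, 0 ≤ᵐ[P] f n)
    (hi : ∀ n, Integrable (f n) P) (hlim : Tendsto (fun n => ∫ ω, f n ω ∂P) atTop (𝓝 0))
    {δ : ℝ} (hδ : 0 < δ) : Tendsto (fun n => P {ω | δ ≤ f n ω}) atTop (𝓝 0) := by
  have h := ENNReal.tendsto_ofReal (hlim.div_const δ)
  rw [zero_div, ENNReal.ofReal_zero] at h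
  exact tendsto_of_tendsto_of_tendsto_of_le_of_le tendsto_const_nhds h (fun _ => zero_le)
    fun n => measure_le_setOf_le_ofReal (hf n) (hi n) hδ le_rfl

end Vanishing

/-! ### Measurability of derivatives with respect to a parameter -/

section MeasurableDeriv

variable {α E G : Type*} [MeasurableSpace α] {m : Measure α} [NormedAddCommGroup G]
  [NormedSpace ℝ G] [MeasurableSpace G] [BorelSpace G] [SecondCountableTopology G]

/-- A directional derivative is the limit of difference quotients along b + v/n, so measurability in
y at each fixed parameter is enough; no joint measurability enters. -/
lemma aemeasurable_fderiv_apply_of_ae_differentiableAt [NormedAddCommGroup E] [NormedSpace ℝ E]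
    {f : α → E → G} {s : Set E} {b : E} (hs : s ∈ 𝓝 b) (hf : ∀ t ∈ s, AEMeasurable (fun y => f y t) m)
    (hd : ∀ᵐ y ∂m, DifferentiableAt ℝ (f y) b) (v : E) :
    AEMeasurable (fun y => fderiv ℝ (f y) b v) m := by
  have hlim : Tendsto (fun n : ℕ => b + (n : ℝ)⁻¹ • v) atTop (𝓝 b) := by
    have := ((tendsto_inv_atTop_nhds_zero_nat (𝕜 := ℝ)).smul_const v).const_add b
    simpa using this
  -- The sequence is shifted by N so that every quotient uses parameters in `s` only.
  obtain ⟨N, hN⟩ := eventually_atTop.1 (hlim.eventually_mem hs)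
  refine aemeasurable_of_tendsto_metrizable_ae atTop
    (f := fun (n : ℕ) y => ((n + N : ℕ) : ℝ) • (f y (b + ((n + N : ℕ) : ℝ)⁻¹ • v) - f y b))
    (fun n => ?_) ?_
  · exact AEMeasurable.const_smul
      (g := fun y => f y (b + ((n + N : ℕ) : ℝ)⁻¹ • v) - f y b)
      ((hf _ (hN _ (Nat.le_add_left _ _))).sub (hf _ (mem_of_mem_nhds hs))) _
  · filter_upwards [hd] with y hy
    refine hy.hasFDerivAt.lim v ?_
    simp only [Real.norm_natCast]
    exact tendsto_natCast_atTop_atTop.comp (tendsto_add_atTop_nat N)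

/-- An operator depends continuously on its values on an orthonormal basis, and these are
directional derivatives. -/
lemma aemeasurable_fderiv_of_ae_differentiableAt [NormedAddCommGroup E] [InnerProductSpace ℝ E]
    [FiniteDimensional ℝ E]
    {f : α → E → G} {s : Set E} {b : E} (hs : s ∈ 𝓝 b) (hf : ∀ t ∈ s, AEMeasurable (fun y => f y t) m)
    (hd : ∀ᵐ y ∂m, DifferentiableAt ℝ (f y) b) :
    AEMeasurable (fun y => fderiv ℝ (f y) b) m := by
  set e := stdOrthonormalBasis ℝ E
  set L : (Fin (Module.finrank ℝ E) → G) → (E →L[ℝ] G) := fun g =>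
    ∑ j, ContinuousLinearMap.smulRightL ℝ E G (innerSL ℝ (e j)) (g j) with hL
  have hLc : Continuous L := by
    refine continuous_finsetSum _ fun j _ => ?_
    exact (ContinuousLinearMap.continuous _).comp (continuous_apply j)
  have hT : ∀ T : E →L[ℝ] G, L (fun j => T (e j)) = T := by
    intro T
    ext x
    conv_rhs => rw [← e.sum_repr' x]
    simp [hL]
  have hm : AEMeasurable (fun y j => fderiv ℝ (f y) b (e j)) m :=
    aemeasurable_pi_lambda _ fun j => aemeasurable_fderiv_apply_of_ae_differentiableAt hs hf hd _
  have := hLc.measurable.comp_aemeasurable hm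
  simpa only [Function.comp_def, hT] using this

lemma aemeasurable_gradient_of_ae_differentiableAt [NormedAddCommGroup E] [InnerProductSpace ℝ E]
    [FiniteDimensional ℝ E] [CompleteSpace E] [MeasurableSpace E] [BorelSpace E]
    {f : α → E → ℝ} {s : Set E} {b : E} (hs : s ∈ 𝓝 b) (hf : ∀ t ∈ s, AEMeasurable (fun y => f y t) m)
    (hd : ∀ᵐ y ∂m, DifferentiableAt ℝ (f y) b) :
    AEMeasurable (fun y => gradient (f y) b) m := by
  have h := aemeasurable_fderiv_of_ae_differentiableAt hs hf hd
  exact (InnerProductSpace.toDual ℝ E).symm.continuous.measurable.comp_aemeasurable h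

end MeasurableDeriv

/-! ### Measurability of the scores and Hessians -/

namespace ModelFamily

variable {p q : ℕ} {Obs : Type*} [MeasurableSpace Obs] {ν : Measure Obs}
  {Ω : Type*} [MeasurableSpace Ω] {P : Measure Ω} {Y : ℕ → Ω → Obs} {F : ModelFamily p q Obs ν}
  {A : Finset (Fin q)} {b bs : SubParam p A}

lemma ae_mem_supp_law (hb : b ∈ F.Θ A) (i : ℕ) : ∀ᵐ y ∂F.law A i b, y ∈ F.supp i := by
  rw [law, ae_withDensity_iff (F.measurable_density A i b hb).ennreal_ofReal]
  refine ae_of_all _ fun y hy => ?_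
  rw [← F.support_density A i b hb, Function.mem_support]
  rintro h
  exact hy (by simp [h])

lemma measurable_logDensity (hb : b ∈ F.Θ A) (i : ℕ) :
    Measurable fun y => F.logDensity A i y b :=
  (F.measurable_density A i b hb).log

lemma aemeasurable_score {m : Measure Obs} {i : ℕ} (hm : ∀ᵐ y ∂m, y ∈ F.supp i)
    (hreg : F.Regular P Y A bs) (hb : b ∈ F.Θ A) : AEMeasurable (fun y => F.score A i y b) m :=
  aemeasurable_gradient_of_ae_differentiableAt ((F.isOpen_Θ A).mem_nhds hb)
    (fun _ ht => (measurable_logDensity ht i).aemeasurable)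
    (hm.mono fun y hy => hreg.differentiableAt i y hy b hb)

lemma aemeasurable_hess {m : Measure Obs} {i : ℕ} (hm : ∀ᵐ y ∂m, y ∈ F.supp i)
    (hreg : F.Regular P Y A bs) (hbs : bs ∈ F.Θ A) : AEMeasurable (fun y => F.hess A i y bs) m := by
  obtain ⟨r, hr, D, -, -, hD, -⟩ := hreg.hess_continuous 1 one_pos
  exact aemeasurable_fderiv_of_ae_differentiableAt ((F.isOpen_Θ A).mem_nhds hbs)
    (fun t ht => aemeasurable_score hm hreg ht)
    (hm.mono fun y hy => (hD i y hy bs (Metric.mem_ball_self hr)).2.1)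

lemma norm_fderiv_logDensity (i : ℕ) (y : Obs) (b : SubParam p A) :
    ‖fderiv ℝ (F.logDensity A i y) b‖ = ‖F.score A i y b‖ :=
  ((InnerProductSpace.toDual ℝ (SubParam p A)).symm.norm_map _).symm

end ModelFamily

/-! ### Consistency of the maximum likelihood estimators -/

namespace ModelFamily

variable {p q : ℕ} {Obs : Type*} [MeasurableSpace Obs] {ν : Measure Obs}
  {Ω : Type*} [MeasurableSpace Ω] {P : Measure Ω}
  {Y : ℕ → Ω → Obs} {F : ModelFamily p q Obs ν}
  {A : Finset (Fin q)} {b bs : SubParam p A} {bhat : ℕ → Ω → SubParam p A}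

/-- On compact sets of parameters the log-likelihoods are locally Lipschitz, with constants which
do not depend on the parameter and are bounded on average. -/
lemma Regular.exists_lipschitz_bound (hreg : F.Regular P Y A bs) (hY : ∀ i, ∀ᵐ ω ∂P, Y i ω ∈ F.supp i)
    {K : Set (SubParam p A)} (hK : IsCompact K) (hKΘ : K ⊆ F.Θ A) :
    ∃ D : ℕ → Obs → ℝ, ∃ C : ℝ, 0 ≤ C ∧ (∀ i, Integrable (fun ω => D i (Y i ω)) P) ∧
      (∀ i, 0 ≤ᵐ[P] fun ω => D i (Y i ω)) ∧
      (∀ n : ℕ, ∑ i ∈ Finset.range n, ∫ ω, D i (Y i ω) ∂P ≤ C * n) ∧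
      ∀ x ∈ K, ∃ r > 0, ∀ i, ∀ y ∈ F.supp i, ∀ t ∈ Metric.ball x r,
        |F.logDensity A i y t - F.logDensity A i y x| ≤ D i y * ‖t - x‖ := by
  choose! r hr B C hBm hBi hB hC using hreg.score_dominated
  -- Half radii: a point within r z / 2 of some x in the half ball around z stays in the full ball,
  -- where the score is bounded by B z.
  obtain ⟨t, htK, hcov⟩ := hK.elim_nhds_subcover (fun x => Metric.ball x (r x / 2)) fun x hx =>
    Metric.ball_mem_nhds _ (half_pos (hr x (hKΘ hx)))
  have hB0 : ∀ x ∈ t, ∀ i, ∀ y ∈ F.supp i, 0 ≤ B x i y := fun x hx i y hy =>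
    (norm_nonneg _).trans (hB x (hKΘ (htK x hx)) i y hy x
      (Metric.mem_ball_self (hr x (hKΘ (htK x hx))))).2
  refine ⟨fun i y => ∑ x ∈ t, B x i y, ∑ x ∈ t, |C x|, Finset.sum_nonneg fun _ _ => abs_nonneg _,
    fun i => integrable_finsetSum _ fun x hx => hBi x (hKΘ (htK x hx)) i, fun i => ?_,
    fun n => ?_, fun x hx => ?_⟩
  · filter_upwards [hY i] with ω hω
    exact Finset.sum_nonneg fun x hx => hB0 x hx i _ hω
  · simp_rw [fun i => integral_finsetSum t fun x hx => hBi x (hKΘ (htK x hx)) i]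
    rw [Finset.sum_comm, Finset.sum_mul]
    refine Finset.sum_le_sum fun x hx => (hC x (hKΘ (htK x hx)) n).trans ?_
    gcongr
    exact le_abs_self _
  · obtain ⟨z, hz, hxz⟩ : ∃ z ∈ t, x ∈ Metric.ball z (r z / 2) := by
      simpa using hcov hx
    have hzΘ := hKΘ (htK z hz)
    refine ⟨r z / 2, half_pos (hr z hzΘ), fun i y hy t' ht' => ?_⟩
    have hxz' : x ∈ Metric.ball z (r z) :=
      Metric.ball_subset_ball (by linarith [hr z hzΘ]) hxz
    have htz : t' ∈ Metric.ball z (r z) := by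
      rw [Metric.mem_ball] at *
      linarith [dist_triangle t' x z]
    have h := (convex_ball z (r z)).norm_image_sub_le_of_norm_fderiv_le (𝕜 := ℝ)
      (f := F.logDensity A i y) (C := B z i y)
      (fun u hu => hreg.differentiableAt i y hy u (hB z hzΘ i y hy u hu).1)
      (fun u hu => by
        rw [norm_fderiv_logDensity]
        exact (hB z hzΘ i y hy u hu).2) hxz' htz
    rw [Real.norm_eq_abs] at h
    refine h.trans ?_
    gcongr
    exact Finset.single_le_sum (f := fun x => B x i y) (fun x hx => hB0 x hx i y hy) hz

variable [IsProbabilityMeasure P]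

lemma Regular.exists_tendsto_measure_average_ge (hreg : F.Regular P Y A bs)
    (hYindep : iIndepFun Y P) (hbs : bs ∈ F.Θ A) (hb : b ∈ F.Θ A) (hne : b ≠ bs) :
    ∃ m < 0, Tendsto (fun n : ℕ => P {ω | m ≤ (n : ℝ)⁻¹ * ∑ i ∈ Finset.range n,
      (F.logDensity A i (Y i ω) b - F.logDensity A i (Y i ω) bs)}) atTop (𝓝 0) := by
  obtain ⟨m, hm, hlim⟩ := hreg.identifiable b hb hne
  -- The mean is eventually below 3m/4, so an average of at least m/2 deviates from it by at least
  -- −m/4, which the weak law excludes.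
  refine ⟨m / 2, by linarith, ?_⟩
  have hUI := hreg.logDensity_uniformIntegrable b hb
  have hind : iIndepFun (fun i ω => F.logDensity A i (Y i ω) b - F.logDensity A i (Y i ω) bs) P :=
    hYindep.comp (fun i y => F.logDensity A i y b - F.logDensity A i y bs)
      fun i => (measurable_logDensity hb i).sub (measurable_logDensity hbs i)
  have hint := fun i => memLp_one_iff_integrable.1 (hUI.memLp i)
  have hL1 := tendsto_integral_abs_average_sub hUI hind
  have hP := tendsto_measure_le_zero (P := P) (fun n => ae_of_all _ fun ω => abs_nonneg _)
    (fun n => ((integrable_finsetSum _ fun i _ =>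
      (hint i).sub (integrable_const _)).const_mul _).abs) hL1 (δ := -m / 4) (by linarith)
  refine tendsto_measure_zero_of_ae_imp hP ?_
  filter_upwards [hlim.eventually_lt_const (u := 3 * m / 4) (by linarith)] with n hn
  refine ae_of_all _ fun ω hω => ?_
  simp only [Pi.sub_apply] at hω ⊢
  rw [Finset.sum_sub_distrib, mul_sub]
  refine le_trans ?_ (le_abs_self _)
  linarith

/-- Outside of each neighbourhood of the pseudo-true parameter, the likelihood is smaller than at
the pseudo-true parameter, with probability tending to one. -/
lemma Regular.tendsto_measure_exists_logLik_ge (hreg : F.Regular P Y A bs)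
    (hYindep : iIndepFun Y P) (hY : ∀ i, ∀ᵐ ω ∂P, Y i ω ∈ F.supp i) (hbs : bs ∈ F.Θ A)
    {K : Set (SubParam p A)} (hK : IsCompact K) (hKΘ : K ⊆ F.Θ A) (hbsK : bs ∉ K) :
    Tendsto (fun n => P {ω | ∃ b ∈ K, F.logLik A n (fun i => Y i ω) bs
      ≤ F.logLik A n (fun i => Y i ω) b}) atTop (𝓝 0) := by
  obtain ⟨D, C, hC0, hDi, hD0, hDC, hD⟩ := hreg.exists_lipschitz_bound hY hK hKΘ
  have hav := fun b (hb : b ∈ K) => hreg.exists_tendsto_measure_average_ge hYindep hbs (hKΘ hb)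
    (fun h => hbsK (h ▸ hb))
  choose! m hm hav using hav
  choose! r hr hD using hD
  refine tendsto_measure_zero_of_ae_imp_or fun ε hε => ?_
  -- By Markov's inequality the average Lipschitz constant exceeds L with probability at most C/L ≤
  -- ε.
  set L : ℝ := (C + 1) / ε with hL
  have hL0 : 0 < L := by positivity
  -- Within this radius the average log-likelihood rises by at most −m x, too little to offset its
  -- deficit at the centre x.
  set δ : SubParam p A → ℝ := fun x => min (r x) (-m x / L) with hδ
  have hδ0 : ∀ x ∈ K, 0 < δ x := fun x hx =>
    lt_min (hr x hx) (div_pos (by linarith [hm x hx]) hL0)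
  obtain ⟨t, htK, hcov⟩ := hK.elim_nhds_subcover (fun x => Metric.ball x (δ x)) fun x hx =>
    Metric.ball_mem_nhds _ (hδ0 x hx)
  refine ⟨fun n => ⋃ x ∈ t, {ω | m x ≤ (n : ℝ)⁻¹ * ∑ i ∈ Finset.range n,
      (F.logDensity A i (Y i ω) x - F.logDensity A i (Y i ω) bs)},
    fun n => {ω | L ≤ (n : ℝ)⁻¹ * ∑ i ∈ Finset.range n, D i (Y i ω)},
    tendsto_measure_biUnion_zero t fun x hx => hav x (htK x hx), ?_, ?_⟩
  · filter_upwards [eventually_gt_atTop 0] with n hn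
    have hn0 : (0 : ℝ) < n := by exact_mod_cast hn
    have h0 : 0 ≤ᵐ[P] fun ω => (n : ℝ)⁻¹ * ∑ i ∈ Finset.range n, D i (Y i ω) := by
      filter_upwards [ae_all_iff.2 hD0] with ω hω
      exact mul_nonneg (by positivity) (Finset.sum_nonneg fun i _ => hω i)
    refine (measure_le_setOf_le_ofReal h0 ((integrable_finsetSum _ fun i _ => hDi i).const_mul _)
      hL0 (C := C) ?_).trans (ENNReal.ofReal_le_ofReal ?_)
    · rw [integral_const_mul, integral_finsetSum _ fun i _ => hDi i, inv_mul_le_iff₀ hn0,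
        mul_comm (n : ℝ)]
      exact hDC n
    · rw [hL, div_div_eq_mul_div, div_le_iff₀ (by positivity)]
      nlinarith
  · filter_upwards [eventually_gt_atTop 0] with n hn
    have hn0 : (0 : ℝ) < n := by exact_mod_cast hn
    filter_upwards [ae_all_iff.2 hY] with ω hω
    rintro ⟨b, hbK, hb⟩
    by_contra! hcon
    obtain ⟨h1, h2⟩ := hcon
    obtain ⟨x, hx, hbx⟩ : ∃ x ∈ t, b ∈ Metric.ball x (δ x) := by simpa using hcov hbK
    have hxK := htK x hx
    have h1' : (n : ℝ)⁻¹ * ∑ i ∈ Finset.range n,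
        (F.logDensity A i (Y i ω) x - F.logDensity A i (Y i ω) bs) < m x := by
      by_contra! h
      exact h1 (Set.mem_biUnion hx h)
    rw [Metric.mem_ball, dist_eq_norm] at hbx
    have hbr : b ∈ Metric.ball x (r x) := by
      rw [Metric.mem_ball, dist_eq_norm]
      exact hbx.trans_le (min_le_left _ _)
    have h3 : ∑ i ∈ Finset.range n, (F.logDensity A i (Y i ω) b - F.logDensity A i (Y i ω) x)
        ≤ (∑ i ∈ Finset.range n, D i (Y i ω)) * ‖b - x‖ := by
      rw [Finset.sum_mul]
      exact Finset.sum_le_sum fun i _ =>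
        (le_abs_self _).trans (hD x hxK i (Y i ω) (hω i) b hbr)
    have h4 : 0 ≤ (n : ℝ)⁻¹ * ∑ i ∈ Finset.range n,
        (F.logDensity A i (Y i ω) b - F.logDensity A i (Y i ω) bs) := by
      rw [Finset.sum_sub_distrib]
      exact mul_nonneg (by positivity) (sub_nonneg.2 hb)
    have h5 : (n : ℝ)⁻¹ * ∑ i ∈ Finset.range n,
        (F.logDensity A i (Y i ω) b - F.logDensity A i (Y i ω) bs)
        = (n : ℝ)⁻¹ * ∑ i ∈ Finset.range n,
          (F.logDensity A i (Y i ω) b - F.logDensity A i (Y i ω) x)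
        + (n : ℝ)⁻¹ * ∑ i ∈ Finset.range n,
          (F.logDensity A i (Y i ω) x - F.logDensity A i (Y i ω) bs) := by
      rw [← mul_add, ← Finset.sum_add_distrib]
      simp
    have h6 : (n : ℝ)⁻¹ * ∑ i ∈ Finset.range n,
        (F.logDensity A i (Y i ω) b - F.logDensity A i (Y i ω) x) ≤ L * ‖b - x‖ := by
      calc _ ≤ (n : ℝ)⁻¹ * ((∑ i ∈ Finset.range n, D i (Y i ω)) * ‖b - x‖) := by gcongr
        _ = ((n : ℝ)⁻¹ * ∑ i ∈ Finset.range n, D i (Y i ω)) * ‖b - x‖ := by ring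
        _ ≤ _ := by gcongr
    have h7 : L * ‖b - x‖ ≤ -m x := by
      have : ‖b - x‖ ≤ -m x / L := hbx.le.trans (min_le_right _ _)
      rwa [le_div_iff₀ hL0, mul_comm] at this
    linarith

/-- A maximizer has likelihood at least that of `bs`. Coercivity rules this out off `K`, and the
preceding lemma rules it out on the compact set `K` minus a ball around `bs`. -/
theorem IsMLE.tendsto_measure_norm_sub_ge (hMLE : F.IsMLE P Y A bhat) (hreg : F.Regular P Y A bs)
    (hYindep : iIndepFun Y P) (hY : ∀ i, ∀ᵐ ω ∂P, Y i ω ∈ F.supp i) (hbs : bs ∈ F.Θ A) {r : ℝ} (hr : 0 < r) :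
    Tendsto (fun n => P {ω | r ≤ ‖bhat n ω - bs‖}) atTop (𝓝 0) := by
  obtain ⟨K, hKΘ, hK, hcoer⟩ := hreg.coercive
  have h := hreg.tendsto_measure_exists_logLik_ge hYindep hY hbs
    (hK.diff (Metric.isOpen_ball (x := bs) (ε := r))) (Set.sdiff_subset.trans hKΘ)
    (fun h => h.2 (Metric.mem_ball_self hr))
  refine tendsto_measure_zero_of_ae_imp
    (tendsto_measure_union_zero hMLE.isMaxOn (tendsto_measure_union_zero hcoer h))
    (Eventually.of_forall fun n => ae_of_all _ fun ω hω => ?_)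
  by_contra hcon
  rw [Set.mem_union, Set.mem_union, not_or, not_or] at hcon
  obtain ⟨h0, h1, h2⟩ := hcon
  obtain ⟨hmem, hmax⟩ : bhat n ω ∈ F.Θ A ∧
      IsMaxOn (F.logLik A n fun i => Y i ω) (F.Θ A) (bhat n ω) := by
    by_contra h
    exact h0 h
  have hge := hmax hbs
  rw [Set.mem_ofPred_eq] at hge hω
  by_cases hbK : bhat n ω ∈ K
  · refine h2 ⟨bhat n ω, ⟨hbK, ?_⟩, hge⟩
    rw [Metric.mem_ball, dist_eq_norm]
    exact hω.not_gt
  · exact h1 ⟨bhat n ω, ⟨hmem, hbK⟩, hge⟩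

end ModelFamily

/-! ### Asymptotic linearity of the maximum likelihood estimators -/

/-- Independent centred terms are orthogonal in L², coordinate by coordinate. -/
lemma integral_norm_sum_sq_eq_of_iIndepFun {Ω : Type*} [MeasurableSpace Ω] {P : Measure Ω}
    [IsProbabilityMeasure P] {ι : Type*} [Fintype ι] {X : ℕ → Ω → EuclideanSpace ℝ ι}
    (hX : ∀ i, MemLp (X i) 2 P) (hX0 : ∀ i, ∫ ω, X i ω ∂P = 0) (hind : iIndepFun X P) (n : ℕ) :
    ∫ ω, ‖∑ i ∈ Finset.range n, X i ω‖ ^ 2 ∂P = ∑ i ∈ Finset.range n, ∫ ω, ‖X i ω‖ ^ 2 ∂P := by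
  have hcoord : ∀ k i, MemLp (fun ω => X i ω k) 2 P := fun k i =>
    (EuclideanSpace.proj (𝕜 := ℝ) k).comp_memLp' (hX i)
  have h0 : ∀ k i, ∫ ω, X i ω k ∂P = 0 := by
    intro k i
    have := (EuclideanSpace.proj (𝕜 := ℝ) k).integral_comp_comm ((hX i).integrable (by norm_num))
    simpa [hX0 i] using this
  have hindk : ∀ k, iIndepFun (fun i ω => X i ω k) P := fun k =>
    hind.comp (fun _ x => x k) fun _ => by fun_prop
  have hk : ∀ k, ∫ ω, (∑ i ∈ Finset.range n, X i ω k) ^ 2 ∂P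
      = ∑ i ∈ Finset.range n, ∫ ω, X i ω k ^ 2 ∂P := by
    intro k
    have hv := IndepFun.variance_sum (s := Finset.range n) (X := fun i ω => X i ω k) (μ := P)
      (fun i _ => hcoord k i) fun i _ j _ hij => (hindk k).indepFun hij
    rw [variance_of_integral_eq_zero (Finset.aemeasurable_sum _ fun i _ =>
      (hcoord k i).1.aemeasurable)] at hv
    · simp_rw [variance_of_integral_eq_zero (hcoord k _).1.aemeasurable (h0 k _)] at hv
      simpa using hv
    · simp only [Finset.sum_apply]
      rw [integral_finsetSum _ fun i _ => (hcoord k i).integrable (by norm_num)]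
      exact Finset.sum_eq_zero fun i _ => h0 k i
  simp_rw [EuclideanSpace.real_norm_sq_eq, WithLp.ofLp_sum, Finset.sum_apply]
  rw [integral_finsetSum _ fun k _ => (memLp_finsetSum _ fun i _ => hcoord k i).integrable_sq]
  simp_rw [hk]
  rw [Finset.sum_comm]
  refine Finset.sum_congr rfl fun i _ => ?_
  rw [integral_finsetSum _ fun k _ => (hcoord k i).integrable_sq]

namespace ModelFamily

variable {p q : ℕ} {Obs : Type*} [MeasurableSpace Obs] {ν : Measure Obs}
  {Ω : Type*} [MeasurableSpace Ω] {P : Measure Ω}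
  {Y : ℕ → Ω → Obs} {F : ModelFamily p q Obs ν}
  {A : Finset (Fin q)} {b bs : SubParam p A} {bhat : ℕ → Ω → SubParam p A}

/-- Subtract the equations for the sample sizes i + 1 and i. -/
lemma IsPseudoTrue.integral_score (h : F.IsPseudoTrue P Y A bs) (hreg : F.Regular P Y A bs)
    [IsProbabilityMeasure P] (i : ℕ) : ∫ ω, F.score A i (Y i ω) bs ∂P = 0 := by
  have hint := fun i => (hreg.memLp_score i).integrable (by norm_num)
  have e : ∀ n, ∑ i ∈ Finset.range n, ∫ ω, F.score A i (Y i ω) bs ∂P = 0 := fun n => by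
    rw [← integral_finsetSum _ fun i _ => hint i]
    exact h.integral_score_eq_zero n
  have h1 := e (i + 1)
  rwa [Finset.sum_range_succ, e i, zero_add] at h1

lemma iIndepFun_score (hYm : ∀ i, Measurable (Y i)) (hYindep : iIndepFun Y P)
    (hY : ∀ i, ∀ᵐ y ∂P.map (Y i), y ∈ F.supp i) (hreg : F.Regular P Y A bs) (hbs : bs ∈ F.Θ A) :
    iIndepFun (fun i ω => F.score A i (Y i ω) bs) P :=
  hYindep.comp₀ (fun i y => F.score A i y bs) (fun i => (hYm i).aemeasurable)
    fun i => aemeasurable_score (hY i) hreg hbs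

lemma totalScore_eq_zero_of_isMaxOn (hreg : F.Regular P Y A bs) {n : ℕ} {y : ℕ → Obs}
    (hy : ∀ i, y i ∈ F.supp i) (hb : b ∈ F.Θ A) (hmax : IsMaxOn (F.logLik A n y) (F.Θ A) b) :
    F.totalScore A n y b = 0 := by
  have h0 : fderiv ℝ (F.logLik A n y) b = 0 :=
    (hmax.isLocalMax ((F.isOpen_Θ A).mem_nhds hb)).fderiv_eq_zero
  have h1 : fderiv ℝ (F.logLik A n y) b
      = ∑ i ∈ Finset.range n, fderiv ℝ (F.logDensity A i (y i)) b :=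
    fderiv_fun_sum fun i _ => hreg.differentiableAt i (y i) (hy i) b hb
  rw [h1] at h0
  have h2 : F.totalScore A n y b = (InnerProductSpace.toDual ℝ (SubParam p A)).symm
      (∑ i ∈ Finset.range n, fderiv ℝ (F.logDensity A i (y i)) b) := by
    rw [map_sum]
    rfl
  rw [h2, h0, map_zero]

variable [IsProbabilityMeasure P]

/-- The score of the sample, scaled by `1 / √n`, is bounded in probability. -/
lemma exists_measure_norm_totalScore_ge_le (hYm : ∀ i, Measurable (Y i)) (hYindep : iIndepFun Y P)
    (hY : ∀ i, ∀ᵐ y ∂P.map (Y i), y ∈ F.supp i) (hreg : F.Regular P Y A bs)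
    (hbs : F.IsPseudoTrue P Y A bs) {ε : ℝ} (hε : 0 < ε) :
    ∃ L > 0, ∀ᶠ n : ℕ in atTop,
      P {ω | L ≤ ‖(√n)⁻¹ • F.totalScore A n (fun i => Y i ω) bs‖} ≤ ENNReal.ofReal ε := by
  obtain ⟨V, hV⟩ := hreg.score_sq_bounded
  -- Chebyshev's inequality then gives exactly (|V| + 1)/L² = ε.
  set L := √((|V| + 1) / ε) with hL
  have hL2 : L ^ 2 = (|V| + 1) / ε := Real.sq_sqrt (by positivity)
  have hL0 : 0 < L := Real.sqrt_pos.2 (by positivity)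
  refine ⟨L, hL0, ?_⟩
  filter_upwards [eventually_gt_atTop 0] with n hn
  have hn0 : (0 : ℝ) < n := by exact_mod_cast hn
  have hmem : MemLp (fun ω => F.totalScore A n (fun i => Y i ω) bs) 2 P :=
    memLp_finsetSum _ fun i _ => hreg.memLp_score i
  have hsq : ∀ ω, ‖(√n)⁻¹ • F.totalScore A n (fun i => Y i ω) bs‖ ^ 2
      = (n : ℝ)⁻¹ * ‖F.totalScore A n (fun i => Y i ω) bs‖ ^ 2 := by
    intro ω
    rw [norm_smul, mul_pow, norm_inv, Real.norm_eq_abs, inv_pow, sq_abs,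
      Real.sq_sqrt hn0.le]
  have hE : ∫ ω, ‖(√n)⁻¹ • F.totalScore A n (fun i => Y i ω) bs‖ ^ 2 ∂P ≤ |V| + 1 := by
    simp_rw [hsq]
    rw [integral_const_mul, inv_mul_le_iff₀ hn0]
    have := integral_norm_sum_sq_eq_of_iIndepFun hreg.memLp_score
      (fun i => hbs.integral_score hreg i) (iIndepFun_score hYm hYindep hY hreg hbs.mem) n
    have e := hV n
    rw [← this] at e
    refine e.trans ?_
    nlinarith [le_abs_self V]
  have hint : Integrable (fun ω => ‖(√n)⁻¹ • F.totalScore A n (fun i => Y i ω) bs‖ ^ 2) P := by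
    simp_rw [hsq]
    exact hmem.norm.integrable_sq.const_mul _
  have h := measure_le_setOf_le_ofReal (P := P) (ae_of_all _ fun ω => sq_nonneg _) hint
    (δ := L ^ 2) (by positivity) hE
  refine (measure_mono fun ω hω => ?_).trans (h.trans (ENNReal.ofReal_le_ofReal ?_))
  · exact pow_le_pow_left₀ hL0.le hω 2
  · rw [hL2]
    apply le_of_eq
    field_simp

/-- The score equation, linearized at the pseudo-true parameter. -/
lemma tendsto_measure_linearized_score (hYm : ∀ i, Measurable (Y i)) (hYindep : iIndepFun Y P)
    (hY : ∀ i, ∀ᵐ y ∂P.map (Y i), y ∈ F.supp i) (hreg : F.Regular P Y A bs) (hbs : bs ∈ F.Θ A)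
    {H : SubParam p A ≃L[ℝ] SubParam p A} (hH : F.IsLimitHessian P Y A bs H)
    (hMLE : F.IsMLE P Y A bhat) {δ : ℝ} (hδ : 0 < δ) :
    Tendsto (fun n : ℕ => P {ω | δ * ‖bhat n ω - bs‖ <
      ‖(n : ℝ)⁻¹ • F.totalScore A n (fun i => Y i ω) bs + H (bhat n ω - bs)‖}) atTop (𝓝 0) := by
  have hYω : ∀ i, ∀ᵐ ω ∂P, Y i ω ∈ F.supp i := fun i => ae_of_ae_map (hYm i).aemeasurable (hY i)
  refine tendsto_measure_zero_of_ae_imp_or fun ε hε => ?_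
  -- With this modulus, Markov's inequality at level δ/2 gives probability at most ε.
  obtain ⟨r, hr, D, -, hDi, hD, hDη⟩ := hreg.hess_continuous (ε * (δ / 2)) (by positivity)
  have hUI := hreg.hess_uniformIntegrable
  have hcons := hMLE.tendsto_measure_norm_sub_ge hreg hYindep hYω hbs hr
  have hhint := fun i => memLp_one_iff_integrable.1 (hUI.memLp i)
  have hL1 := tendsto_integral_norm_average_sub hUI fun f =>
    hYindep.comp₀ (fun i y => f (F.hess A i y bs)) (fun i => (hYm i).aemeasurable)
      fun i => f.continuous.measurable.comp_aemeasurable (aemeasurable_hess (hY i) hreg hbs)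
  have hdev : Tendsto (fun n : ℕ => P {ω | δ / 4 ≤ ‖(n : ℝ)⁻¹ • ∑ i ∈ Finset.range n,
      (F.hess A i (Y i ω) bs - ∫ ω', F.hess A i (Y i ω') bs ∂P)‖}) atTop (𝓝 0) :=
    tendsto_measure_le_zero (P := P) (fun n => ae_of_all _ fun ω => norm_nonneg _)
      (fun n => Integrable.norm (Integrable.smul (n : ℝ)⁻¹ (integrable_finsetSum _ fun i _ =>
        (hhint i).sub (integrable_const _)))) hL1 (δ := δ / 4) (by positivity)
  refine ⟨_, fun n => {ω | δ / 2 ≤ (n : ℝ)⁻¹ * ∑ i ∈ Finset.range n, D i (Y i ω)},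
    tendsto_measure_union_zero hMLE.isMaxOn (tendsto_measure_union_zero hcons hdev), ?_, ?_⟩
  · have hD0 : ∀ i, 0 ≤ᵐ[P] fun ω => D i (Y i ω) := fun i => by
      filter_upwards [hYω i] with ω hω
      exact (norm_nonneg _).trans (hD i _ hω bs (Metric.mem_ball_self hr)).2.2
    filter_upwards [eventually_gt_atTop 0, hDη] with n hn hnη
    have hn0 : (0 : ℝ) < n := by exact_mod_cast hn
    have h0 : 0 ≤ᵐ[P] fun ω => (n : ℝ)⁻¹ * ∑ i ∈ Finset.range n, D i (Y i ω) := by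
      filter_upwards [ae_all_iff.2 hD0] with ω hω
      exact mul_nonneg (by positivity) (Finset.sum_nonneg fun i _ => hω i)
    refine (measure_le_setOf_le_ofReal h0 ((integrable_finsetSum _ fun i _ => hDi i).const_mul _)
      (half_pos hδ) (C := ε * (δ / 2)) ?_).trans (ENNReal.ofReal_le_ofReal ?_)
    · rw [integral_const_mul, integral_finsetSum _ fun i _ => hDi i, inv_mul_le_iff₀ hn0,
        mul_comm (n : ℝ)]
      exact hnη
    · apply le_of_eq
      field_simp
  · filter_upwards [eventually_gt_atTop 0, (Metric.tendsto_nhds.1 hH) (δ / 4) (by positivity)]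
      with n hn hHn
    have hn0 : (0 : ℝ) < n := by exact_mod_cast hn
    filter_upwards [ae_all_iff.2 hYω] with ω hω hlt
    by_contra hcon
    rw [Set.mem_union, Set.mem_union, not_or, not_or, not_or] at hcon
    obtain ⟨⟨h0, h1, h2⟩, h3⟩ := hcon
    simp only [Set.mem_ofPred_eq, not_le] at h1 h2 h3
    obtain ⟨hmem, hmax⟩ : bhat n ω ∈ F.Θ A ∧
        IsMaxOn (F.logLik A n fun i => Y i ω) (F.Θ A) (bhat n ω) := by
      by_contra h
      exact h0 h
    have hS0 := totalScore_eq_zero_of_isMaxOn hreg hω hmem hmax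
    set h := bhat n ω - bs with hh
    have hball : bhat n ω ∈ Metric.ball bs r := by rwa [Metric.mem_ball, dist_eq_norm]
    -- Mean value inequality for the score minus its linear part at `bs`: the derivative of the
    -- difference is bounded by D on the ball.
    have hmv : ‖F.totalScore A n (fun i => Y i ω) (bhat n ω) - F.totalScore A n (fun i => Y i ω) bs
        - (∑ i ∈ Finset.range n, F.hess A i (Y i ω) bs) h‖
        ≤ (∑ i ∈ Finset.range n, D i (Y i ω)) * ‖h‖ := by
      rw [totalScore, totalScore, sum_apply, ← Finset.sum_sub_distrib,
        ← Finset.sum_sub_distrib, Finset.sum_mul]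
      refine (norm_sum_le _ _).trans (Finset.sum_le_sum fun i _ => ?_)
      exact (convex_ball bs r).norm_image_sub_le_of_norm_fderiv_le' (𝕜 := ℝ)
        (fun t ht => (hD i _ (hω i) t ht).2.1) (fun t ht => (hD i _ (hω i) t ht).2.2)
        (Metric.mem_ball_self hr) hball
    rw [hS0, zero_sub, ← neg_add', norm_neg] at hmv
    set S := F.totalScore A n (fun i => Y i ω) bs
    have hHn' : ‖(n : ℝ)⁻¹ • ∑ i ∈ Finset.range n, F.hess A i (Y i ω) bs - (H : _ →L[ℝ] _)‖
        ≤ δ / 2 := by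
      rw [dist_eq_norm] at hHn
      rw [Finset.sum_sub_distrib, smul_sub] at h2
      have := norm_sub_le_norm_sub_add_norm_sub
        ((n : ℝ)⁻¹ • ∑ i ∈ Finset.range n, F.hess A i (Y i ω) bs)
        ((n : ℝ)⁻¹ • ∑ i ∈ Finset.range n, ∫ ω', F.hess A i (Y i ω') bs ∂P)
        (H : SubParam p A →L[ℝ] SubParam p A)
      linarith
    -- The first term is the Taylor remainder of the score, the second the deviation of the average
    -- Hessian from H; each is at most δ/2 · ‖h‖.
    have e : (n : ℝ)⁻¹ • S + H h = (n : ℝ)⁻¹ • (S + (∑ i ∈ Finset.range n, F.hess A i (Y i ω) bs) h)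
        - ((n : ℝ)⁻¹ • ∑ i ∈ Finset.range n, F.hess A i (Y i ω) bs - (H : SubParam p A →L[ℝ] SubParam p A)) h := by
      simp only [smul_add, sub_apply, smul_apply,
        ContinuousLinearEquiv.coe_coe]
      abel
    have hle : ‖(n : ℝ)⁻¹ • S + H h‖ ≤ δ / 2 * ‖h‖ + δ / 2 * ‖h‖ := by
      rw [e]
      refine (norm_sub_le _ _).trans (add_le_add ?_ ?_)
      · rw [norm_smul, norm_inv, Real.norm_natCast]
        calc _ ≤ (n : ℝ)⁻¹ * ((∑ i ∈ Finset.range n, D i (Y i ω)) * ‖h‖) := by gcongr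
          _ = ((n : ℝ)⁻¹ * ∑ i ∈ Finset.range n, D i (Y i ω)) * ‖h‖ := by ring
          _ ≤ _ := by gcongr
      · exact (ContinuousLinearMap.le_opNorm _ _).trans (by gcongr)
    linarith

end ModelFamily

/-! ### Root-n consistency and the delta method -/

namespace ModelFamily

variable {p q l : ℕ} {Obs : Type*} [MeasurableSpace Obs] {ν : Measure Obs}
  {Ω : Type*} [MeasurableSpace Ω] {P : Measure Ω} [IsProbabilityMeasure P]
  {Y : ℕ → Ω → Obs} {F : ModelFamily p q Obs ν}
  {A : Finset (Fin q)} {b bs : SubParam p A} {bhat : ℕ → Ω → SubParam p A}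

/-- `√n`-consistency of the maximum likelihood estimator. -/
lemma IsMLE.exists_measure_sqrt_mul_norm_sub_gt_le (hMLE : F.IsMLE P Y A bhat)
    (hYm : ∀ i, Measurable (Y i)) (hYindep : iIndepFun Y P)
    (hY : ∀ i, ∀ᵐ y ∂P.map (Y i), y ∈ F.supp i) (hreg : F.Regular P Y A bs)
    (hbs : F.IsPseudoTrue P Y A bs)
    {H : SubParam p A ≃L[ℝ] SubParam p A} (hH : F.IsLimitHessian P Y A bs H)
    {ε : ℝ} (hε : 0 < ε) :
    ∃ L > 0, ∀ᶠ n : ℕ in atTop, P {ω | L < √n * ‖bhat n ω - bs‖} ≤ ENNReal.ofReal ε := by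
  set c : ℝ := ‖(H.symm : SubParam p A →L[ℝ] SubParam p A)‖ + 1 with hc
  have hc0 : 0 < c := by positivity
  obtain ⟨L, hL0, hL⟩ := exists_measure_norm_totalScore_ge_le hYm hYindep hY hreg hbs (half_pos hε)
  -- Since ‖h‖ ≤ c‖H h‖, an error of ‖h‖/(2c) costs only half of ‖h‖ and can be absorbed on the
  -- left.
  have hlin := tendsto_measure_linearized_score hYm hYindep hY hreg hbs.mem hH hMLE
    (δ := 1 / (2 * c)) (by positivity)
  refine ⟨2 * c * L, by positivity, ?_⟩
  have hlin' := ENNReal.tendsto_nhds_zero.1 hlin (ENNReal.ofReal (ε / 2))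
    (ENNReal.ofReal_pos.2 (half_pos hε))
  filter_upwards [hL, hlin', eventually_gt_atTop 0] with n h1 h2 hn
  have hn0 : (0 : ℝ) < n := by exact_mod_cast hn
  have hsn : 0 < √(n : ℝ) := Real.sqrt_pos.2 hn0
  refine (measure_mono ?_).trans ((measure_union_le _ _).trans ((add_le_add h2 h1).trans ?_))
  · intro ω hω
    by_contra hcon
    rw [Set.mem_union, not_or] at hcon
    obtain ⟨hle, hSL⟩ := hcon
    simp only [Set.mem_ofPred_eq, not_le, not_lt] at hle hSL
    set h := bhat n ω - bs
    set S := F.totalScore A n (fun i => Y i ω) bs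
    have hinv : ‖h‖ ≤ c * ‖H h‖ := by
      have := (H.symm : SubParam p A →L[ℝ] SubParam p A).le_opNorm (H h)
      simp only [ContinuousLinearEquiv.coe_coe, ContinuousLinearEquiv.symm_apply_apply] at this
      refine this.trans ?_
      gcongr
      simp [hc]
    have hHh : ‖H h‖ ≤ 1 / (2 * c) * ‖h‖ + ‖(n : ℝ)⁻¹ • S‖ := by
      have : H h = ((n : ℝ)⁻¹ • S + H h) - (n : ℝ)⁻¹ • S := by abel
      calc ‖H h‖ = ‖((n : ℝ)⁻¹ • S + H h) - (n : ℝ)⁻¹ • S‖ := by rw [← this]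
        _ ≤ _ := (norm_sub_le _ _).trans (by gcongr)
    have hh : ‖h‖ ≤ 2 * c * ‖(n : ℝ)⁻¹ • S‖ := by
      have h5 : ‖h‖ ≤ c * (1 / (2 * c) * ‖h‖ + ‖(n : ℝ)⁻¹ • S‖) :=
        hinv.trans (by gcongr)
      have h6 : c * (1 / (2 * c) * ‖h‖ + ‖(n : ℝ)⁻¹ • S‖) = ‖h‖ / 2 + c * ‖(n : ℝ)⁻¹ • S‖ := by
        field_simp
      linarith
    have hs : √n * ‖(n : ℝ)⁻¹ • S‖ = ‖(√n)⁻¹ • S‖ := by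
      rw [norm_smul, norm_smul, ← mul_assoc, norm_inv, norm_inv, Real.norm_natCast,
        Real.norm_of_nonneg hsn.le]
      congr 1
      rw [← div_eq_mul_inv, Real.sqrt_div_self]
    have hω' : 2 * c * L < √n * ‖h‖ := hω
    have h7 : √n * ‖h‖ ≤ 2 * c * ‖(√n)⁻¹ • S‖ := by
      rw [← hs]
      calc _ ≤ √n * (2 * c * ‖(n : ℝ)⁻¹ • S‖) := by gcongr
        _ = _ := by ring
    have h8 : 2 * c * ‖(√n)⁻¹ • S‖ ≤ 2 * c * L := by gcongr
    linarith
  · rw [← ENNReal.ofReal_add (by positivity) (by positivity), add_halves]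

/-- The map that fills the missing components of a parameter vector with zeros. -/
noncomputable def augmentCLM (p : ℕ) {q : ℕ} (A : Finset (Fin q)) :
    SubParam p A →L[ℝ] FullParam p q :=
  LinearMap.toContinuousLinearMap
    { toFun := augment 0
      map_add' := fun x y => by
        ext (i | j)
        · simp [augment]
        · by_cases h : j ∈ A <;> simp [augment, h]
      map_smul' := fun a x => by
        ext (i | j)
        · simp [augment]
        · by_cases h : j ∈ A <;> simp [augment, h] }

lemma augment_sub_augment (c : Fin q → ℝ) (x y : SubParam p A) :
    augment c x - augment c y = augmentCLM p A (x - y) := by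
  change _ = augment 0 (x - y)
  ext (i | j)
  · simp [augment]
  · by_cases h : j ∈ A <;> simp [augment, h]

lemma measurable_augment (c : Fin q → ℝ) : Measurable (augment (p := p) (A := A) c) := by
  have : augment (p := p) (A := A) c = fun x => augmentCLM p A x + augment (A := A) c 0 := by
    ext1 x
    rw [← sub_eq_iff_eq_add, augment_sub_augment, sub_zero]
  rw [this]
  fun_prop

/-- Asymptotic linearity of a differentiable function of the maximum likelihood estimator. -/
lemma IsMLE.tendsto_measure_sqrt_smul_sub_add_sum_influence (hMLE : F.IsMLE P Y A bhat)
    (hYm : ∀ i, Measurable (Y i)) (hYindep : iIndepFun Y P)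
    (hY : ∀ i, ∀ᵐ y ∂P.map (Y i), y ∈ F.supp i) (hreg : F.Regular P Y A bs)
    (hbs : F.IsPseudoTrue P Y A bs)
    {H : SubParam p A ≃L[ℝ] SubParam p A} (hH : F.IsLimitHessian P Y A bs H)
    {μ : FullParam p q → EuclideanSpace ℝ (Fin l)} {c : Fin q → ℝ}
    (hμ : DifferentiableAt ℝ μ (augment c bs)) {δ : ℝ} (hδ : 0 < δ) :
    Tendsto (fun n : ℕ => P {ω | δ ≤ ‖√n • (μ (augment c (bhat n ω)) - μ (augment c bs))
      + (√n)⁻¹ • ∑ i ∈ Finset.range n, F.influence μ A c bs H i (Y i ω)‖}) atTop (𝓝 0) := by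
  have hYω : ∀ i, ∀ᵐ ω ∂P, Y i ω ∈ F.supp i := fun i => ae_of_ae_map (hYm i).aemeasurable (hY i)
  set T : SubParam p A →L[ℝ] EuclideanSpace ℝ (Fin l) :=
    (fderiv ℝ μ (augment c bs)).comp (augmentCLM p A) with hT
  set TH : SubParam p A →L[ℝ] EuclideanSpace ℝ (Fin l) := T.comp (H.symm : SubParam p A →L[ℝ] SubParam p A) with hTH
  set a : ℝ := ‖augmentCLM p A‖ + 1 with ha
  set t : ℝ := ‖TH‖ + 1 with ht
  have ha0 : 0 < a := by positivity
  have ht0 : 0 < t := by positivity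
  refine tendsto_measure_zero_of_ae_imp_or fun ε hε => ?_
  obtain ⟨L, hL0, hL⟩ :=
    hMLE.exists_measure_sqrt_mul_norm_sub_gt_le hYm hYindep hY hreg hbs hH hε
  -- On the event √n‖h‖ ≤ L, this makes the remainder of μ, scaled by √n, at most δ/4. The tolerance
  -- δ/(4tL) below does the same for the linearized score equation.
  set κ : ℝ := δ / (4 * (a * L)) with hκ
  have hκ0 : 0 < κ := by positivity
  obtain ⟨ρ, hρ, hdiff⟩ := Metric.eventually_nhds_iff.1 (hμ.hasFDerivAt.isLittleO.def hκ0)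
  have hcons := hMLE.tendsto_measure_norm_sub_ge hreg hYindep hYω hbs.mem (r := ρ / a)
    (by positivity)
  have hlin := tendsto_measure_linearized_score hYm hYindep hY hreg hbs.mem hH hMLE
    (δ := δ / (4 * (t * L))) (by positivity)
  refine ⟨_, _, tendsto_measure_union_zero hcons hlin, hL, ?_⟩
  filter_upwards [eventually_gt_atTop 0] with n hn
  have hn0 : (0 : ℝ) < n := by exact_mod_cast hn
  have hsn : 0 < √(n : ℝ) := Real.sqrt_pos.2 hn0
  refine ae_of_all _ fun ω hω => ?_
  by_contra hcon
  rw [Set.mem_union, not_or, not_or] at hcon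
  obtain ⟨⟨h1, h2⟩, h3⟩ := hcon
  simp only [Set.mem_ofPred_eq, not_le, not_lt] at h1 h2 h3
  replace hω : δ ≤ ‖√n • (μ (augment c (bhat n ω)) - μ (augment c bs))
      + (√n)⁻¹ • ∑ i ∈ Finset.range n, F.influence μ A c bs H i (Y i ω)‖ := hω
  set h := bhat n ω - bs with hh
  have hsum : ∑ i ∈ Finset.range n, F.influence μ A c bs H i (Y i ω)
      = TH (F.totalScore A n (fun i => Y i ω) bs) := by
    rw [totalScore, map_sum]
    rfl
  rw [hsum] at hω
  set S := F.totalScore A n (fun i => Y i ω) bs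
  have hnorm : ‖augmentCLM p A h‖ ≤ a * ‖h‖ :=
    ((augmentCLM p A).le_opNorm h).trans (by gcongr; simp [ha])
  have hd : ‖μ (augment c (bhat n ω)) - μ (augment c bs) - T h‖ ≤ κ * (a * ‖h‖) := by
    have hx : dist (augment c (bhat n ω)) (augment c bs) < ρ := by
      rw [dist_eq_norm, augment_sub_augment]
      refine hnorm.trans_lt ?_
      rwa [lt_div_iff₀ ha0, mul_comm] at h1
    have := hdiff hx
    rw [augment_sub_augment] at this
    exact this.trans (by gcongr)
  -- The term T h is subtracted and added back as TH (H h): differentiability of μ controls the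
  -- first summand, the linearized score equation the second.
  have e : √n • (μ (augment c (bhat n ω)) - μ (augment c bs)) + (√n)⁻¹ • TH S
      = √n • (μ (augment c (bhat n ω)) - μ (augment c bs) - T h)
        + √n • TH ((n : ℝ)⁻¹ • S + H h) := by
    have e1 : TH (H h) = T h := by simp [hTH]
    have e2 : √n • (n : ℝ)⁻¹ • TH S = (√n)⁻¹ • TH S := by
      rw [smul_smul]
      congr 1
      rw [← div_eq_mul_inv, Real.sqrt_div_self]
    rw [map_add, e1, map_smul, smul_add, e2, smul_sub √(n : ℝ) _ (T h)]
    abel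
  have hle : ‖√n • (μ (augment c (bhat n ω)) - μ (augment c bs)) + (√n)⁻¹ • TH S‖
      ≤ δ / 4 + δ / 4 := by
    rw [e]
    refine (norm_add_le _ _).trans (add_le_add ?_ ?_)
    · rw [norm_smul, Real.norm_of_nonneg hsn.le]
      calc _ ≤ √n * (κ * (a * ‖h‖)) := by gcongr
        _ = κ * a * (√n * ‖h‖) := by ring
        _ ≤ κ * a * L := by gcongr
        _ = δ / 4 := by rw [hκ]; field_simp
    · rw [norm_smul, Real.norm_of_nonneg hsn.le]
      calc _ ≤ √n * (t * (δ / (4 * (t * L)) * ‖h‖)) := by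
            gcongr
            exact (TH.le_opNorm _).trans (by gcongr; simp [ht])
        _ = t * (δ / (4 * (t * L))) * (√n * ‖h‖) := by ring
        _ ≤ t * (δ / (4 * (t * L))) * L := by gcongr
        _ = δ / 4 := by field_simp
  linarith

end ModelFamily

/-! ### Bounds and measurability for the influence vectors -/

namespace ModelFamily

variable {p q l : ℕ} {Obs : Type*} [MeasurableSpace Obs] {ν : Measure Obs}
  {F : ModelFamily p q Obs ν}
  {μ : FullParam p q → EuclideanSpace ℝ (Fin l)} {M : Finset (Finset (Fin q))}
  {w : Finset (Fin q) → ℝ} {c : Finset (Fin q) → Fin q → ℝ}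
  {bs : ∀ A : Finset (Fin q), SubParam p A}
  {H : ∀ A : Finset (Fin q), SubParam p A ≃L[ℝ] SubParam p A}

/-- A fixed bounded linear map is applied to the score, so square integrability, mean zero and
measurability carry over. -/
lemma influence_eq_clm (A : Finset (Fin q)) (c : Fin q → ℝ) (bs : SubParam p A)
    (H : SubParam p A ≃L[ℝ] SubParam p A) (i : ℕ) (y : Obs) :
    F.influence μ A c bs H i y = (((fderiv ℝ μ (augment c bs)).comp (augmentCLM p A)).comp
      (H.symm : SubParam p A →L[ℝ] SubParam p A)) (F.score A i y bs) :=
  rfl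

lemma norm_influence_le_maxInfluence {A : Finset (Fin q)} (hA : A ∈ M) (i : ℕ) (y : Obs) :
    ‖F.influence μ A (c A) (bs A) (H A) i y‖ ≤ F.maxInfluence μ M c bs H i y := by
  rw [maxInfluence, ← coe_nnnorm, NNReal.coe_le_coe]
  exact Finset.le_sup (f := fun A => ‖F.influence μ A (c A) (bs A) (H A) i y‖₊) hA

lemma maxInfluence_nonneg (i : ℕ) (y : Obs) : 0 ≤ F.maxInfluence μ M c bs H i y :=
  NNReal.coe_nonneg _

lemma maxInfluence_le_sum (i : ℕ) (y : Obs) :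
    F.maxInfluence μ M c bs H i y ≤ ∑ A ∈ M, ‖F.influence μ A (c A) (bs A) (H A) i y‖ := by
  have h : (M.sup fun A => ‖F.influence μ A (c A) (bs A) (H A) i y‖₊)
      ≤ ∑ A ∈ M, ‖F.influence μ A (c A) (bs A) (H A) i y‖₊ :=
    Finset.sup_le fun A hA => Finset.single_le_sum
      (f := fun A => ‖F.influence μ A (c A) (bs A) (H A) i y‖₊) (fun _ _ => zero_le) hA
  have h' := NNReal.coe_le_coe.2 h
  rw [NNReal.coe_sum] at h'
  exact h'

/-- The weights form a convex combination; this is the link between (A1) and Lindeberg's condition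
for the weighted sum. -/
lemma norm_sum_smul_influence_le (hw : ∀ A ∈ M, 0 ≤ w A) (hw_sum : ∑ A ∈ M, w A = 1) (i : ℕ)
    (y : Obs) : ‖∑ A ∈ M, w A • F.influence μ A (c A) (bs A) (H A) i y‖
      ≤ F.maxInfluence μ M c bs H i y := by
  calc _ ≤ ∑ A ∈ M, ‖w A • F.influence μ A (c A) (bs A) (H A) i y‖ := norm_sum_le _ _
    _ ≤ ∑ A ∈ M, w A * F.maxInfluence μ M c bs H i y := by
        refine Finset.sum_le_sum fun A hA => ?_
        rw [norm_smul, Real.norm_of_nonneg (hw A hA)]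
        exact mul_le_mul_of_nonneg_left (norm_influence_le_maxInfluence hA i y) (hw A hA)
    _ = _ := by rw [← Finset.sum_mul, hw_sum, one_mul]

lemma aemeasurable_maxInfluence {α : Type*} [MeasurableSpace α] {P : Measure α} {i : ℕ}
    {Y : α → Obs} (h : ∀ A ∈ M, AEMeasurable (fun ω => F.influence μ A (c A) (bs A) (H A) i (Y ω)) P) :
    AEMeasurable (fun ω => F.maxInfluence μ M c bs H i (Y ω)) P := by
  have h1 : AEMeasurable (M.sup fun A ω => ‖F.influence μ A (c A) (bs A) (H A) i (Y ω)‖₊) P :=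
    Finset.sup_induction (p := fun f : α → NNReal => AEMeasurable f P) aemeasurable_const
      (fun _ h₁ _ h₂ => h₁.sup h₂) fun A hA => (h A hA).nnnorm
  have h2 := h1.coe_nnreal_real
  convert h2 using 2 with ω
  rw [maxInfluence, Finset.sup_apply]

end ModelFamily

/-! ### Averaging over the models -/

theorem theorem1 {p q l : ℕ} {Obs : Type*} [MeasurableSpace Obs] {ν : Measure Obs}
    (F : ModelFamily p q Obs ν)
    {Ω : Type*} [MeasurableSpace Ω] (P : Measure Ω) [IsProbabilityMeasure P]
    -- independent observations from the true model `A₀` with parameter `b₀`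
    (Y : ℕ → Ω → Obs) (hYm : ∀ i, Measurable (Y i)) (hYindep : iIndepFun Y P)
    (A₀ : Finset (Fin q)) (b₀ : SubParam p A₀) (hb₀ : b₀ ∈ F.Θ A₀)
    (hYlaw : ∀ i, P.map (Y i) = F.law A₀ i b₀)
    -- the true parameter, augmented to full length
    (c₀ : Fin q → ℝ) (βtrue : FullParam p q) (hβtrue : βtrue = augment c₀ b₀)
    -- the candidate models, their weights and the values used for augmentation
    (M : Finset (Finset (Fin q))) (w : Finset (Fin q) → ℝ)
    (hw : ∀ A ∈ M, 0 ≤ w A) (hw_sum : ∑ A ∈ M, w A = 1)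
    (c : Finset (Fin q) → Fin q → ℝ)
    -- pseudo-true parameters, regularity conditions, limiting Hessians, estimators
    (bs : ∀ A : Finset (Fin q), SubParam p A) (hbs : ∀ A ∈ M, F.IsPseudoTrue P Y A (bs A))
    (hreg : ∀ A ∈ M, F.Regular P Y A (bs A))
    (H : ∀ A : Finset (Fin q), SubParam p A ≃L[ℝ] SubParam p A)
    (hH : ∀ A ∈ M, F.IsLimitHessian P Y A (bs A) (H A))
    (bhat : ∀ A : Finset (Fin q), ℕ → Ω → SubParam p A)
    (hbhat : ∀ A ∈ M, F.IsMLE P Y A (bhat A))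
    -- the parameter of interest
    (μ : FullParam p q → EuclideanSpace ℝ (Fin l)) (hμm : Measurable μ)
    (hμ : ∀ A ∈ M, DifferentiableAt ℝ μ (augment (c A) (bs A)))
    (hA1 : F.LindebergCondition P Y μ M c bs H)
    (S : Matrix (Fin l) (Fin l) ℝ) (hS : F.IsLimitVariance P Y μ M w c bs H S) :
    TendstoInDistribution
      (fun (n : ℕ) ω =>
        √n • ∑ A ∈ M, w A • (μ (augment (c A) (bhat A n ω)) - μ βtrue)
          - √n • ∑ A ∈ M, w A • (μ (augment (c A) (bs A)) - μ βtrue))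
      atTop id (fun _ => P) (multivariateGaussian 0 S) := by
  have hY : ∀ i, ∀ᵐ y ∂P.map (Y i), y ∈ F.supp i := fun i => by
    rw [hYlaw i]
    exact ModelFamily.ae_mem_supp_law hb₀ i
  have hinfl : ∀ A ∈ M, ∀ i,
      MemLp (fun ω => F.influence μ A (c A) (bs A) (H A) i (Y i ω)) 2 P := by
    intro A hA i
    simp_rw [ModelFamily.influence_eq_clm]
    exact ContinuousLinearMap.comp_memLp' _ ((hreg A hA).memLp_score i)
  have hinfl0 : ∀ A ∈ M, ∀ i, ∫ ω, F.influence μ A (c A) (bs A) (H A) i (Y i ω) ∂P = 0 := by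
    intro A hA i
    simp_rw [ModelFamily.influence_eq_clm]
    rw [ContinuousLinearMap.integral_comp_comm _ (((hreg A hA).memLp_score i).integrable
      (by norm_num)), (hbs A hA).integral_score (hreg A hA) i, map_zero]
  -- The minus sign comes from solving the linearized score equation for β̂ − β*; second moments and
  -- norms are unaffected.
  set Z : ℕ → Obs → EuclideanSpace ℝ (Fin l) := fun i y =>
    -∑ A ∈ M, w A • F.influence μ A (c A) (bs A) (H A) i y with hZ
  have hZm : ∀ i, AEMeasurable (Z i) (P.map (Y i)) := fun i => by
    refine (Finset.aemeasurable_fun_sum _ fun A hA => ?_).neg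
    refine AEMeasurable.const_smul (g := fun y => F.influence μ A (c A) (bs A) (H A) i y) ?_ (w A)
    simp_rw [ModelFamily.influence_eq_clm]
    exact (ContinuousLinearMap.continuous _).measurable.comp_aemeasurable
      (ModelFamily.aemeasurable_score (hY i) (hreg A hA) (hbs A hA).mem)
  have hZL : ∀ i, MemLp (fun ω => Z i (Y i ω)) 2 P := fun i =>
    (memLp_finsetSum _ fun A hA => (hinfl A hA i).const_smul (w A)).neg
  have hZ0 : ∀ i, ∫ ω, Z i (Y i ω) ∂P = 0 := fun i => by
    have hint : ∀ A ∈ M,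
        Integrable (fun ω => w A • F.influence μ A (c A) (bs A) (H A) i (Y i ω)) P :=
      fun A hA => ((hinfl A hA i).const_smul (w A)).integrable (by norm_num)
    simp only [hZ]
    rw [integral_neg, integral_finsetSum _ hint, neg_eq_zero]
    refine Finset.sum_eq_zero fun A hA => ?_
    rw [integral_smul, hinfl0 A hA i, smul_zero]
  have hZindep : iIndepFun (fun i ω => Z i (Y i ω)) P :=
    hYindep.comp₀ Z (fun i => (hYm i).aemeasurable) hZm
  have hclt := tendstoInDistribution_of_lindeberg (S := S) hZL hZ0 hZindep
    (fun r s => by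
      refine (hS r s).congr fun n => ?_
      simp [hZ])
    (fun ε hε => by
      refine squeeze_zero (fun n => mul_nonneg (by positivity) (Finset.sum_nonneg fun i _ =>
        integral_nonneg fun ω => Set.indicator_nonneg (fun _ _ => sq_nonneg _) _)) (fun n => ?_)
        (hA1 ε hε)
      refine mul_le_mul_of_nonneg_left (Finset.sum_le_sum fun i _ => ?_) (by positivity)
      -- A non-integrable function has integral 0 by convention, so (A1) controls the smaller
      -- integrand only once the maximum is known to be square integrable; the finite sum over the
      -- models dominates it.
      have hmax : MemLp (fun ω => F.maxInfluence μ M c bs H i (Y i ω)) 2 P := by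
        refine (memLp_finsetSum M fun A hA => (hinfl A hA i).norm).mono'
          (ModelFamily.aemeasurable_maxInfluence fun A hA =>
            (hinfl A hA i).1.aemeasurable).aestronglyMeasurable (ae_of_all _ fun ω => ?_)
        rw [Real.norm_of_nonneg (ModelFamily.maxInfluence_nonneg _ _)]
        exact ModelFamily.maxInfluence_le_sum _ _
      refine integral_mono_of_nonneg
        (ae_of_all _ fun ω => Set.indicator_nonneg (fun _ _ => sq_nonneg _) _)
        (hmax.integrable_sq.indicator₀ (nullMeasurableSet_lt aemeasurable_const
          hmax.1.aemeasurable)) (ae_of_all _ fun ω => ?_)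
      have hle : ‖Z i (Y i ω)‖ ≤ F.maxInfluence μ M c bs H i (Y i ω) := by
        simp only [hZ, norm_neg]
        exact ModelFamily.norm_sum_smul_influence_le hw hw_sum i _
      simp only [Set.indicator_apply, Set.mem_ofPred_eq]
      split_ifs with h1 h2 h2
      · gcongr
      · exact absurd (h1.trans_le hle) h2
      · positivity
      · rfl)
  -- Slutsky's lemma: it remains to show that the difference from the normalized sum of the Z tends
  -- to 0 in probability.
  refine tendstoInDistribution_of_tendstoInMeasure_sub _ _ hclt ?_ fun n => ?_
  · rw [tendstoInMeasure_iff_norm]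
    intro δ hδ
    have hA := fun A (hA : A ∈ M) =>
      (hbhat A hA).tendsto_measure_sqrt_smul_sub_add_sum_influence hYm hYindep hY (hreg A hA)
        (hbs A hA) (hH A hA) (hμ A hA) (half_pos hδ)
    refine tendsto_measure_zero_of_ae_imp (tendsto_measure_biUnion_zero M hA)
      (Eventually.of_forall fun n => ae_of_all _ fun ω hω => ?_)
    by_contra hcon
    simp only [Set.mem_iUnion, Set.mem_ofPred_eq, not_exists, not_le] at hcon
    -- With μ(βtrue) cancelled and the sums exchanged, the difference is the weighted average of the
    -- remainders of the single models, each below δ/2 off the exceptional events.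
    have e : (√n • ∑ A ∈ M, w A • (μ (augment (c A) (bhat A n ω)) - μ βtrue)
          - √n • ∑ A ∈ M, w A • (μ (augment (c A) (bs A)) - μ βtrue))
        - (√n)⁻¹ • ∑ i ∈ Finset.range n, Z i (Y i ω)
        = ∑ A ∈ M, w A • (√n • (μ (augment (c A) (bhat A n ω)) - μ (augment (c A) (bs A)))
          + (√n)⁻¹ • ∑ i ∈ Finset.range n, F.influence μ A (c A) (bs A) (H A) i (Y i ω)) := by
      simp only [hZ]
      rw [← smul_sub, ← Finset.sum_sub_distrib, Finset.sum_neg_distrib, Finset.sum_comm,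
        smul_neg, sub_neg_eq_add, Finset.smul_sum, Finset.smul_sum, ← Finset.sum_add_distrib]
      refine Finset.sum_congr rfl fun A _ => ?_
      rw [← Finset.smul_sum, ← smul_sub, sub_sub_sub_cancel_right, smul_add, smul_comm (w A),
        smul_comm (w A)]
    have hω' : δ ≤ ‖∑ A ∈ M, w A • (√n • (μ (augment (c A) (bhat A n ω))
        - μ (augment (c A) (bs A)))
          + (√n)⁻¹ • ∑ i ∈ Finset.range n, F.influence μ A (c A) (bs A) (H A) i (Y i ω))‖ := by
      rw [← e]
      simpa using hω
    have hle : ‖∑ A ∈ M, w A • (√n • (μ (augment (c A) (bhat A n ω))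
        - μ (augment (c A) (bs A)))
          + (√n)⁻¹ • ∑ i ∈ Finset.range n, F.influence μ A (c A) (bs A) (H A) i (Y i ω))‖
        ≤ δ / 2 := by
      refine (norm_sum_le _ _).trans ?_
      calc _ ≤ ∑ A ∈ M, w A * (δ / 2) := by
            refine Finset.sum_le_sum fun A hA => ?_
            rw [norm_smul, Real.norm_of_nonneg (hw A hA)]
            exact mul_le_mul_of_nonneg_left (hcon A hA).le (hw A hA)
        _ = δ / 2 := by rw [← Finset.sum_mul, hw_sum, one_mul]
    linarith
  · have h : AEMeasurable (fun ω => ∑ A ∈ M, w A • (μ (augment (c A) (bhat A n ω)) - μ βtrue)) P :=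
      Finset.aemeasurable_fun_sum _ fun A hA => AEMeasurable.const_smul
        (g := fun ω => μ (augment (c A) (bhat A n ω)) - μ βtrue)
        (((hμm.comp (ModelFamily.measurable_augment (c A))).comp_aemeasurable
          ((hbhat A hA).aemeasurable n)).sub_const _) (w A)
    exact (AEMeasurable.const_smul
      (g := fun ω => ∑ A ∈ M, w A • (μ (augment (c A) (bhat A n ω)) - μ βtrue)) h √n).sub_const _
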